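/- Let $K$ be a complex Hilbert space, not necessarily separable, with inner product $\langle\cdot,\cdot\rangle$ linear in the first variable. Let $(\Xi,\mathscr G)$ be a measurable space and let $Q\colon\mathscr G\to B(K)$ be a projection-valued measure: each $Q(G)$ is an orthogonal projection, $Q(\Xi)=\mathrm{id}_K$, and $Q$ is countably additive in the weak operator topology. For a bounded measurable $f\colon\Xi\to\mathbb C$, let $Q(f)=\int_\Xi f\,dQ\in B(K)$ be the unique operator with $\langle Q(f)h,k\rangle=\int_\Xi f\,dQ_{h,k}$ for all $h,k\in K$, where $Q_{h,k}$ is the complex measure $G\mapsto\langle Q(G)h,k\rangle$. Let $(\Sigma,\mathscr H,\rho)$ be a measure space. A map $F\colon\Sigma\to B(K)$ is pointwise weakly measurable if $\sigma\mapsto\langle F(\sigma)h,k\rangle$ is measurable for all $h,k\in K$. It is pointwise Pettis integrable if, in addition, $\int_\Sigma|\langle F(\sigma)h,k\rangle|\,\rho(d\sigma)<\infty$ for all $h,k\in K$; in that case $\int_\Sigma F\,d\rho\in B(K)$ denotes the unique operator with $\big\langle\big(\int_\Sigma F\,d\rho\big)h,k\big\rangle=\int_\Sigma\langle F(\sigma)h,k\rangle\,\rho(d\sigma)$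 for all $h,k\in K$. For $T\in B(K)$ and an orthonormal basis $\mathcal E$ of $K$, put $\|T\|_{\mathcal S_1}=\sum_{e\in\mathcal E}\langle|T|e,e\rangle\in[0,\infty]$ with $|T|=(T^*T)^{1/2}$, let $\mathcal S_1(K)=\{T\in B(K):\|T\|_{\mathcal S_1}<\infty\}$, and for $T\in\mathcal S_1(K)$ let $\operatorname{Tr}(T)=\sum_{e\in\mathcal E}\langle Te,e\rangle$; these do not depend on $\mathcal E$. **Theorem (Trace of Integral of a Product).** Suppose that $\rho$ is finite, that $\varphi\colon\Xi\times\Sigma\to\mathbb C$ is bounded and $\mathscr G\otimes\mathscr H$-measurable, and that $A\colon\Sigma\to B(K)$ is pointwise weakly measurable with $\sup_{\sigma\in\Sigma}\|A(\sigma)\|_{\mathcal S_1}<\infty$. Then $\sigma\mapsto A(\sigma)\,Q(\varphi(\cdot,\sigma))$ and $\sigma\mapsto Q(\varphi(\cdot,\sigma))\,A(\sigma)$ are pointwise Pettis integrable, $$\int_\Sigma A(\sigma)\,Q(\varphi(\cdot,\sigma))\,\rho(d\sigma),\quad \int_\Sigma Q(\varphi(\cdot,\sigma))\,A(\sigma)\,\rho(d\sigma)\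 \in\ \mathcal S_1(K),$$ and $$\operatorname{Tr}\Big(\int_\Sigma A(\sigma)\,Q(\varphi(\cdot,\sigma))\,\rho(d\sigma)\Big)=\operatorname{Tr}\Big(\int_\Sigma Q(\varphi(\cdot,\sigma))\,A(\sigma)\,\rho(d\sigma)\Big).$$ -/

import Mathlib

open MeasureTheory Filter Topology
open scoped InnerProductSpace ENNReal NNReal

/-! Inner products in Mathlib are linear in the second variable: `⟪k, T h⟫_ℂ` is the number that is
written `⟨T h, k⟩` when inner products are linear in the first variable. -/

section Sesquilinear

variable {K L : Type*} [NormedAddCommGroup K] [InnerProductSpace ℂ K] [CompleteSpace K]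
  [NormedAddCommGroup L] [InnerProductSpace ℂ L] [CompleteSpace L]

/-- A separately bounded sesquilinear form is the form of a bounded operator. -/
theorem exists_clm_of_separately_bounded (B : K → L → ℂ)
    (hadd : ∀ h h' k, B (h + h') k = B h k + B h' k)
    (hsmul : ∀ (c : ℂ) h k, B (c • h) k = c * B h k)
    (hadd' : ∀ h k k', B h (k + k') = B h k + B h k')
    (hsmul' : ∀ (c : ℂ) h k, B h (c • k) = (starRingEnd ℂ) c * B h k)
    (hb : ∀ h, ∃ C, ∀ k, ‖B h k‖ ≤ C * ‖k‖)
    (hb' : ∀ k, ∃ C, ∀ h, ‖B h k‖ ≤ C * ‖h‖) :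
    ∃ T : K →L[ℂ] L, ∀ h k, ⟪k, T h⟫_ℂ = B h k := by
  -- the vector representing `k ↦ conj (B h k)`
  have hrep : ∀ h, ∃ v : L, ∀ k, ⟪k, v⟫_ℂ = B h k := by
    intro h
    obtain ⟨C, hC⟩ := hb h
    let ℓ : L →L[ℂ] ℂ := LinearMap.mkContinuous
      { toFun := fun k => (starRingEnd ℂ) (B h k)
        map_add' := by intro x y; simp [hadd']
        map_smul' := by intro c x; simp [hsmul'] } C (by intro k; simpa using hC k)
    refine ⟨(InnerProductSpace.toDual ℂ L).symm ℓ, fun k => ?_⟩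
    rw [← inner_conj_symm, InnerProductSpace.toDual_symm_apply]
    simp [ℓ]
  choose v hv using hrep
  let T₀ : K →ₗ[ℂ] L :=
    { toFun := v
      map_add' := fun x y => ext_inner_left ℂ fun k => by simp [inner_add_right, hv, hadd]
      map_smul' := fun c x => ext_inner_left ℂ fun k => by simp [inner_smul_right, hv, hsmul] }
  -- uniform boundedness
  choose C' hC' using hb'
  let g : {k : L // ‖k‖ ≤ 1} → K →L[ℂ] ℂ := fun k => LinearMap.mkContinuous
    { toFun := fun h => B h k
      map_add' := by intro x y; simp [hadd]
      map_smul' := by intro c x; simp [hsmul] } (C' k) (by intro h; simpa using hC' k h)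
  obtain ⟨D, hD⟩ : ∃ D, ∀ k, ‖g k‖ ≤ D := by
    apply banach_steinhaus
    intro h
    obtain ⟨C, hC⟩ := hb h
    refine ⟨max C 0, fun k => (hC k).trans ?_⟩
    calc C * ‖(k : L)‖ ≤ max C 0 * ‖(k : L)‖ := by gcongr; exact le_max_left _ _
      _ ≤ max C 0 * 1 := by gcongr; exact k.2
      _ = max C 0 := mul_one _
  have hT : ∀ h, ‖T₀ h‖ ≤ D * ‖h‖ := by
    intro h
    by_cases h0 : v h = 0
    · have : 0 ≤ D := (norm_nonneg _).trans (hD ⟨0, by simp⟩)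
      have h1 : T₀ h = 0 := h0
      rw [h1, norm_zero]; positivity
    · have hpos : 0 < ‖v h‖ := norm_pos_iff.mpr h0
      let u : L := ((‖v h‖⁻¹ : ℝ) : ℂ) • v h
      have hu : ‖u‖ ≤ 1 := by
        simp only [u, norm_smul, Complex.norm_real, norm_inv, norm_norm]
        rw [inv_mul_cancel₀ hpos.ne']
      have h1 : ‖B h u‖ ≤ D * ‖h‖ :=
        ((g ⟨u, hu⟩).le_opNorm h).trans (by gcongr; exact hD _)
      rw [← hv] at h1
      have h2 : ⟪u, v h⟫_ℂ = (‖v h‖ : ℂ) := by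
        have h3 : (‖v h‖ : ℂ) ≠ 0 := by exact_mod_cast hpos.ne'
        simp only [u, inner_smul_left, inner_self_eq_norm_sq_to_K, Complex.conj_ofReal]
        simp only [Complex.coe_algebraMap, Complex.ofReal_inv]
        field_simp
      rw [h2] at h1
      simpa [T₀] using h1
  exact ⟨T₀.mkContinuous D hT, fun h k => hv h k⟩

end Sesquilinear

/-! ### Projection-valued measures -/

/-- A projection-valued measure on `Ξ` with values in `B(K)`: a set function that is countably
additive in the weak operator topology, whose values on measurable sets are orthogonal projections,
and whose value on the whole space is the identity. (As for every `VectorMeasure`, the value on a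
non-measurable set is `0` by convention.) -/
structure ProjectionValuedMeasure (Ξ : Type*) [MeasurableSpace Ξ] (K : Type*)
    [NormedAddCommGroup K] [InnerProductSpace ℂ K] [CompleteSpace K]
    extends VectorMeasure Ξ (K →WOT[ℂ] K) where
  isStarProjection' : ∀ G, MeasurableSet G → IsStarProjection (measureOf' G)
  univ' : measureOf' Set.univ = 1

namespace ProjectionValuedMeasure

variable {Ξ K : Type*} [MeasurableSpace Ξ] [NormedAddCommGroup K] [InnerProductSpace ℂ K]
  [CompleteSpace K]

/-- The bounded operator `P(G)`. -/
noncomputable def op (P : ProjectionValuedMeasure Ξ K) (G : Set Ξ) : K →L[ℂ] K :=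
  (P.toVectorMeasure G).toCLM

/-- The functional `T ↦ ⟨T h, k⟩` on operators. -/
noncomputable def coordHom (h k : K) : (K →WOT[ℂ] K) →+ ℂ where
  toFun T := ⟪k, T h⟫_ℂ
  map_zero' := by simp
  map_add' := by intro S T; simp

/-- The complex measure `P_{h,k} : G ↦ ⟨P(G) h, k⟩`. -/
noncomputable def coord (P : ProjectionValuedMeasure Ξ K) (h k : K) : ComplexMeasure Ξ :=
  P.toVectorMeasure.mapRange (coordHom h k)
    (ContinuousLinearMapWOT.continuous_inner_apply continuous_id h k)

theorem coord_apply (P : ProjectionValuedMeasure Ξ K) (h k : K) (G : Set Ξ) :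
    P.coord h k G = ⟪k, P.op G h⟫_ℂ := rfl

theorem op_isStarProjection (P : ProjectionValuedMeasure Ξ K) {G : Set Ξ} (hG : MeasurableSet G) :
    IsStarProjection (P.op G) := by
  have h := P.isStarProjection' G hG
  exact ⟨congrArg ContinuousLinearMapWOT.toCLM h.isIdempotentElem,
    congrArg ContinuousLinearMapWOT.toCLM h.isSelfAdjoint⟩

/-- A complex measure has finite total variation. -/
theorem isFiniteMeasure_variation (μ : ComplexMeasure Ξ) : IsFiniteMeasure μ.variation := by
  have h : μ.variation ≤ (ComplexMeasure.re μ).totalVariation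
      + (ComplexMeasure.im μ).totalVariation := by
    apply VectorMeasure.variation_le_of_forall_enorm_le
    intro E _
    have h1 : ‖μ E‖ₑ ≤ ‖(μ E).re‖ₑ + ‖(μ E).im‖ₑ := by
      rw [← ofReal_norm, ← ofReal_norm, ← ofReal_norm,
        ← ENNReal.ofReal_add (norm_nonneg _) (norm_nonneg _)]
      exact ENNReal.ofReal_le_ofReal (Complex.norm_le_abs_re_add_abs_im _)
    refine h1.trans ?_
    rw [Measure.add_apply]
    exact add_le_add (SignedMeasure.enorm_le_totalVariation (ComplexMeasure.re μ) E)
      (SignedMeasure.enorm_le_totalVariation (ComplexMeasure.im μ) E)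
  exact isFiniteMeasure_of_le _ h

/-- The integral of a scalar function against a complex measure. -/
noncomputable def cintegral (μ : ComplexMeasure Ξ) (φ : Ξ → ℂ) : ℂ :=
  VectorMeasure.integral μ φ (ContinuousLinearMap.mul ℝ ℂ)

theorem cintegral_simpleFunc (P : ProjectionValuedMeasure Ξ K) (f : SimpleFunc Ξ ℂ) :
    ∃ T : K →L[ℂ] K, ∀ h k, ⟪k, T h⟫_ℂ = cintegral (P.coord h k) f := by
  have hint : ∀ (f : SimpleFunc Ξ ℂ) (h k : K), (P.coord h k).Integrable f := fun f h k => by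
    have := isFiniteMeasure_variation (P.coord h k)
    exact SimpleFunc.integrable_of_isFiniteMeasure f
  induction f using SimpleFunc.induction with
  | const c hs =>
    rename_i s
    refine ⟨c • P.op s, fun h k => ?_⟩
    have := isFiniteMeasure_variation (P.coord h k)
    have hc : ⇑(SimpleFunc.piecewise s hs (SimpleFunc.const Ξ c) (SimpleFunc.const Ξ 0))
        = s.indicator (fun _ => c) := by
      ext x; simp [Set.indicator, Set.piecewise]
    rw [hc, cintegral, VectorMeasure.integral,
      setToFun_indicator_const _ hs (measure_ne_top _ _)]
    simp [VectorMeasure.transpose, coord_apply, mul_comm]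
  | add hd hf hg =>
    rename_i f g
    obtain ⟨S, hS⟩ := hf
    obtain ⟨T, hT⟩ := hg
    refine ⟨S + T, fun h k => ?_⟩
    rw [add_apply, inner_add_right, hS, hT, cintegral, cintegral, cintegral,
      SimpleFunc.coe_add, VectorMeasure.integral_add (hint f h k) (hint g h k)]

/-- The operator `∫ φ dP` exists for every bounded measurable `φ`. -/
theorem exists_integral (P : ProjectionValuedMeasure Ξ K) {φ : Ξ → ℂ} (hφ : Measurable φ)
    (hb : ∃ C : ℝ, ∀ ξ, ‖φ ξ‖ ≤ C) :
    ∃ T : K →L[ℂ] K, ∀ h k, ⟪k, T h⟫_ℂ = cintegral (P.coord h k) φ := by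
  obtain ⟨C₀, hC₀⟩ := hb
  obtain ⟨C, hC0, hC⟩ : ∃ C : ℝ, 0 ≤ C ∧ ∀ ξ, ‖φ ξ‖ ≤ C :=
    ⟨max C₀ 0, le_max_right _ _, fun ξ => (hC₀ ξ).trans (le_max_left _ _)⟩
  have hsm : StronglyMeasurable φ := hφ.stronglyMeasurable
  choose T hT using fun n => P.cintegral_simpleFunc (hsm.approxBounded C n)
  have hlim : ∀ h k, Tendsto (fun n => ⟪k, T n h⟫_ℂ) atTop (𝓝 (cintegral (P.coord h k) φ)) := by
    intro h k
    have := isFiniteMeasure_variation (P.coord h k)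
    simp_rw [hT]
    exact VectorMeasure.tendsto_integral_of_dominated_convergence (fun _ => C)
      (fun n => (hsm.approxBounded C n).aestronglyMeasurable) (integrable_const _)
      (fun n => Eventually.of_forall fun x => hsm.norm_approxBounded_le hC0 n x)
      (Eventually.of_forall fun x => hsm.tendsto_approxBounded_of_norm_le (hC x))
  refine exists_clm_of_separately_bounded (fun h k => cintegral (P.coord h k) φ) ?_ ?_ ?_ ?_ ?_ ?_
  · intro h h' k
    refine tendsto_nhds_unique (hlim (h + h') k) ?_
    simpa [inner_add_right] using (hlim h k).add (hlim h' k)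
  · intro c h k
    refine tendsto_nhds_unique (hlim (c • h) k) ?_
    simpa [inner_smul_right] using (hlim h k).const_mul c
  · intro h k k'
    refine tendsto_nhds_unique (hlim h (k + k')) ?_
    simpa [inner_add_left] using (hlim h k).add (hlim h k')
  · intro c h k
    refine tendsto_nhds_unique (hlim h (c • k)) ?_
    simpa [inner_smul_left, mul_comm] using (hlim h k).const_mul ((starRingEnd ℂ) c)
  · intro h
    obtain ⟨D, hD⟩ := banach_steinhaus (g := fun n => innerSL ℂ (T n h)) (by
      intro k
      obtain ⟨M, hM⟩ := (hlim h k).norm.bddAbove_range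
      refine ⟨M, fun n => ?_⟩
      rw [innerSL_apply_apply, norm_inner_symm]
      exact hM ⟨n, rfl⟩)
    refine ⟨D, fun k => le_of_tendsto (hlim h k).norm (Eventually.of_forall fun n => ?_)⟩
    rw [norm_inner_symm, ← innerSL_apply_apply ℂ]
    exact ((innerSL ℂ (T n h)).le_opNorm k).trans (by gcongr; exact hD n)
  · intro k
    obtain ⟨D, hD⟩ := banach_steinhaus (g := fun n => (innerSL ℂ k).comp (T n)) (by
      intro h
      obtain ⟨M, hM⟩ := (hlim h k).norm.bddAbove_range
      exact ⟨M, fun n => hM ⟨n, rfl⟩⟩)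
    refine ⟨D, fun h => le_of_tendsto (hlim h k).norm (Eventually.of_forall fun n => ?_)⟩
    exact (((innerSL ℂ k).comp (T n)).le_opNorm h).trans (by gcongr; exact hD n)

open Classical in
/-- The integral `P(φ) = ∫ φ dP` of a bounded measurable function: the bounded operator with
`⟨P(φ) h, k⟩ = ∫ φ dP_{h,k}` for all `h, k` (and `0` if `φ` is not bounded and measurable). -/
noncomputable def integral (P : ProjectionValuedMeasure Ξ K) (φ : Ξ → ℂ) : K →L[ℂ] K :=
  if hφ : Measurable φ ∧ ∃ C : ℝ, ∀ ξ, ‖φ ξ‖ ≤ C then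
    (P.exists_integral hφ.1 hφ.2).choose
  else 0

theorem inner_integral (P : ProjectionValuedMeasure Ξ K) {φ : Ξ → ℂ} (hφ : Measurable φ)
    (hb : ∃ C : ℝ, ∀ ξ, ‖φ ξ‖ ≤ C) (h k : K) :
    ⟪k, P.integral φ h⟫_ℂ = cintegral (P.coord h k) φ := by
  rw [integral, dif_pos ⟨hφ, hb⟩]
  exact (P.exists_integral hφ hb).choose_spec h k

theorem eq_integral (P : ProjectionValuedMeasure Ξ K) {φ : Ξ → ℂ} (hφ : Measurable φ)
    (hb : ∃ C : ℝ, ∀ ξ, ‖φ ξ‖ ≤ C) {T : K →L[ℂ] K}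
    (hT : ∀ h k, ⟪k, T h⟫_ℂ = cintegral (P.coord h k) φ) : T = P.integral φ :=
  ContinuousLinearMap.ext fun h => ext_inner_left ℂ fun k => by
    rw [hT, P.inner_integral hφ hb]

end ProjectionValuedMeasure

/-! ### Pointwise Pettis integrals of operator-valued maps -/

section Pettis

variable {S K L : Type*} [MeasurableSpace S] [NormedAddCommGroup K] [InnerProductSpace ℂ K]
  [NormedAddCommGroup L] [InnerProductSpace ℂ L]

/-- `F` is pointwise weakly measurable: `σ ↦ ⟨F(σ) h, k⟩` is measurable for all `h, k`. -/
def PointwiseWeaklyMeasurable (F : S → K →L[ℂ] L) : Prop :=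
  ∀ h k, Measurable fun σ => ⟪k, F σ h⟫_ℂ

/-- `F` is pointwise Pettis integrable: it is pointwise weakly measurable, and
`σ ↦ ⟨F(σ) h, k⟩` is integrable for all `h, k`. -/
def PointwisePettisIntegrable (F : S → K →L[ℂ] L) (ρ : Measure S) : Prop :=
  PointwiseWeaklyMeasurable F ∧ ∀ h k, Integrable (fun σ => ⟪k, F σ h⟫_ℂ) ρ

theorem exists_bound_integral [CompleteSpace K] {ρ : Measure S} (ℓ : S → K →L[ℂ] ℂ)
    (hint : ∀ x, Integrable (fun σ => ℓ σ x) ρ) :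
    ∃ C, ∀ x, ‖∫ σ, ℓ σ x ∂ρ‖ ≤ C * ‖x‖ := by
  let g : K →ₗ[ℂ] Lp ℂ 1 ρ :=
    { toFun := fun x => (hint x).toL1 _
      map_add' := fun x y => by
        rw [← Integrable.toL1_add]
        congr 1
        ext σ; simp
      map_smul' := fun c x => by
        rw [RingHom.id_apply, ← Integrable.toL1_smul]
        congr 1
        ext σ; simp }
  have hg : Continuous g := by
    apply g.continuous_of_seq_closed_graph
    intro u x y hu hy
    have hmeas := tendstoInMeasure_of_tendsto_Lp hy
    obtain ⟨ns, hns, hae⟩ := hmeas.exists_seq_tendsto_ae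
    have hcoe : ∀ n, (g (u n) : S → ℂ) =ᵐ[ρ] fun σ => ℓ σ (u n) := fun n =>
      (hint (u n)).coeFn_toL1
    apply Lp.ext
    filter_upwards [hae, ae_all_iff.2 hcoe, (hint x).coeFn_toL1] with σ h1 h2 h3
    refine tendsto_nhds_unique h1 ?_
    have h4 : Tendsto (fun i => ℓ σ (u (ns i))) atTop (𝓝 (ℓ σ x)) :=
      ((ℓ σ).continuous.tendsto x).comp (hu.comp hns.tendsto_atTop)
    have h5 : (g x : S → ℂ) σ = ℓ σ x := h3
    rw [h5]
    exact h4.congr fun i => (h2 (ns i)).symm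
  let G : K →L[ℂ] Lp ℂ 1 ρ := ⟨g, hg⟩
  refine ⟨‖G‖, fun x => ?_⟩
  calc ‖∫ σ, ℓ σ x ∂ρ‖ ≤ ∫ σ, ‖ℓ σ x‖ ∂ρ := norm_integral_le_integral_norm _
    _ = ‖G x‖ := by
      have : G x = (hint x).toL1 _ := rfl
      rw [this, L1.norm_of_fun_eq_integral_norm]
    _ ≤ ‖G‖ * ‖x‖ := G.le_opNorm x

variable [CompleteSpace K] [CompleteSpace L]

/-- The integral of a pointwise Pettis integrable map exists as a bounded operator. -/
theorem PointwisePettisIntegrable.exists_integral {F : S → K →L[ℂ] L} {ρ : Measure S}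
    (hF : PointwisePettisIntegrable F ρ) :
    ∃ T : K →L[ℂ] L, ∀ h k, ⟪k, T h⟫_ℂ = ∫ σ, ⟪k, F σ h⟫_ℂ ∂ρ := by
  have hi := hF.2
  refine exists_clm_of_separately_bounded (fun h k => ∫ σ, ⟪k, F σ h⟫_ℂ ∂ρ) ?_ ?_ ?_ ?_ ?_ ?_
  · intro h h' k
    simp only [map_add, inner_add_right]
    exact integral_add (hi h k) (hi h' k)
  · intro c h k
    simp only [map_smul, inner_smul_right]
    exact integral_const_mul _ _
  · intro h k k'
    simp only [inner_add_left]
    exact integral_add (hi h k) (hi h k')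
  · intro c h k
    simp only [inner_smul_left]
    exact integral_const_mul _ _
  · intro h
    obtain ⟨C, hC⟩ := exists_bound_integral (ρ := ρ) (fun σ => innerSL ℂ (F σ h)) (fun k => by
      have := (Complex.conjCLE : ℂ →L[ℝ] ℂ).integrable_comp (hi h k)
      simpa using this)
    refine ⟨C, fun k => ?_⟩
    have h1 : ∫ σ, ⟪k, F σ h⟫_ℂ ∂ρ = (starRingEnd ℂ) (∫ σ, ⟪F σ h, k⟫_ℂ ∂ρ) := by
      rw [← integral_conj]
      simp
    rw [h1, RCLike.norm_conj]
    exact hC k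
  · intro k
    exact exists_bound_integral (ρ := ρ) (fun σ => (innerSL ℂ k).comp (F σ)) (fun h => hi h k)

open Classical in
/-- The pointwise Pettis integral `∫ F dρ`: the bounded operator with
`⟨(∫ F dρ) h, k⟩ = ∫ ⟨F(σ) h, k⟩ ρ(dσ)` for all `h, k` (and `0` if `F` is not pointwise Pettis
integrable). -/
noncomputable def pettisIntegral (F : S → K →L[ℂ] L) (ρ : Measure S) : K →L[ℂ] L :=
  if hF : PointwisePettisIntegrable F ρ then hF.exists_integral.choose else 0

theorem PointwisePettisIntegrable.inner_pettisIntegral {F : S → K →L[ℂ] L} {ρ : Measure S}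
    (hF : PointwisePettisIntegrable F ρ) (h : K) (k : L) :
    ⟪k, pettisIntegral F ρ h⟫_ℂ = ∫ σ, ⟪k, F σ h⟫_ℂ ∂ρ := by
  rw [pettisIntegral, dif_pos hF]
  exact hF.exists_integral.choose_spec h k

theorem PointwisePettisIntegrable.eq_pettisIntegral {F : S → K →L[ℂ] L} {ρ : Measure S}
    (hF : PointwisePettisIntegrable F ρ) {T : K →L[ℂ] L}
    (hT : ∀ h k, ⟪k, T h⟫_ℂ = ∫ σ, ⟪k, F σ h⟫_ℂ ∂ρ) : T = pettisIntegral F ρ :=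
  ContinuousLinearMap.ext fun h => ext_inner_left ℂ fun k => by
    rw [hT, hF.inner_pettisIntegral]

end Pettis

/-! ### Trace class operators -/

section Trace

variable {K : Type*} [NormedAddCommGroup K] [InnerProductSpace ℂ K] [CompleteSpace K]

/-- The index set of a fixed orthonormal basis of `K`, of arbitrary cardinality. -/
def basisSet (K : Type*) [NormedAddCommGroup K] [InnerProductSpace ℂ K] [CompleteSpace K] : Set K :=
  (exists_hilbertBasis ℂ K).choose

/-- A fixed orthonormal basis of `K`. -/
noncomputable def onb (K : Type*) [NormedAddCommGroup K] [InnerProductSpace ℂ K]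
    [CompleteSpace K] : HilbertBasis (basisSet K) ℂ K :=
  (exists_hilbertBasis ℂ K).choose_spec.choose

/-- The trace norm `‖A‖_{S₁} = ∑ₑ ⟨|A| e, e⟩ ∈ [0, ∞]`, where `|A| = (A* A)^{1/2}` and `e` runs
through an orthonormal basis. -/
noncomputable def traceNorm (A : K →L[ℂ] K) : ℝ≥0∞ :=
  ∑' i, ENNReal.ofReal (⟪onb K i, CFC.abs A (onb K i)⟫_ℂ).re

/-- `A` is of trace class, i.e. `A ∈ S₁(K)`. -/
def IsTraceClass (A : K →L[ℂ] K) : Prop := traceNorm A < ⊤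

/-- The trace `Tr A = ∑ₑ ⟨A e, e⟩` of a trace class operator, where `e` runs through an orthonormal
basis. -/
noncomputable def opTrace (A : K →L[ℂ] K) : ℂ := ∑' i, ⟪onb K i, A (onb K i)⟫_ℂ

theorem ofReal_norm_sq_eq_tsum {K : Type*} [NormedAddCommGroup K] [InnerProductSpace ℂ K]
    {ι : Type*} (b : HilbertBasis ι ℂ K) (x : K) :
    ENNReal.ofReal (‖x‖ ^ 2) = ∑' i, ENNReal.ofReal (‖⟪b i, x⟫_ℂ‖ ^ 2) := by
  have h := b.hasSum_inner_mul_inner x x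
  have h1 : HasSum (fun i => ‖⟪b i, x⟫_ℂ‖ ^ 2) (‖x‖ ^ 2) := by
    have h2 := Complex.hasSum_re h
    have h3 : (⟪x, x⟫_ℂ).re = ‖x‖ ^ 2 := inner_self_eq_norm_sq (𝕜 := ℂ) x
    rw [h3] at h2
    refine h2.congr_fun ?_
    intro i
    rw [← inner_conj_symm x (b i), Complex.conj_mul']
    norm_cast
  rw [← h1.tsum_eq, ENNReal.ofReal_tsum_of_nonneg (fun i => by positivity) h1.summable]

/-- The trace norm can be computed in every orthonormal basis. -/
theorem traceNorm_eq {ι : Type*} (b : HilbertBasis ι ℂ K) (A : K →L[ℂ] K) :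
    traceNorm A = ∑' i, ENNReal.ofReal (⟪b i, CFC.abs A (b i)⟫_ℂ).re := by
  set R : K →L[ℂ] K := CFC.sqrt (CFC.abs A) with hR
  have hRR : R * R = CFC.abs A := CFC.sqrt_mul_sqrt_self _ (CFC.abs_nonneg A)
  have hRs : star R = R := (IsSelfAdjoint.of_nonneg (CFC.sqrt_nonneg _)).star_eq
  have hRin : ∀ x y, ⟪x, R y⟫_ℂ = ⟪R x, y⟫_ℂ := fun x y => by
    rw [← ContinuousLinearMap.adjoint_inner_left, ← ContinuousLinearMap.star_eq_adjoint, hRs]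
  have hquad : ∀ x, ENNReal.ofReal (⟪x, CFC.abs A x⟫_ℂ).re = ENNReal.ofReal (‖R x‖ ^ 2) := by
    intro x
    rw [← hRR, mul_apply_eq_comp, hRin]
    congr 1
    exact inner_self_eq_norm_sq (𝕜 := ℂ) _
  simp_rw [traceNorm, hquad]
  simp_rw [fun i => ofReal_norm_sq_eq_tsum b (R (onb K i)), fun i => ofReal_norm_sq_eq_tsum (onb K) (R (b i))]
  rw [ENNReal.tsum_comm]
  refine tsum_congr fun i => tsum_congr fun j => ?_
  rw [hRin, norm_inner_symm]

end Trace

/-! For each σ cyclicity gives Tr(A(σ)Q(φ(·,σ))) = Tr(Q(φ(·,σ))A(σ)), but this cannot simply be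
integrated: for non-separable K the trace of a Pettis integral need not be the integral of the
traces. On ℓ²([0,1]) with Lebesgue measure, let A(σ) be the projection onto the line of e_σ: every
trace is 1, yet the weak integral is 0.

The equality is instead proved by induction on φ. For the indicator of a rectangle s × t, the
constant operator Q(s) leaves the integral, and the claim is cyclicity for the single trace class
operator ∫_t A dρ (`opTrace_pettisIntegral_slice_prod`). Linear combinations are immediate. What
remains is that both traces pass to bounded pointwise limits of φ
(`tendsto_opTrace_pettisIntegral`). A trace class operator kills all but countably many basis
vectors, so one countable set J serves the whole sequence and its limit. Over J, sum and integral
commute and dominated convergence applies, and for fixed σ convergence holds because X ↦ Tr(AX) is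
continuous along bounded weakly convergent sequences (`tendsto_tsum_inner_comp`).

The trace class estimates rest on writing A as a product VW of Hilbert–Schmidt operators, and on
bounding the trace norm by finite sums ∑⟨Te, Ue⟩ over contractions U, which commute with the
integral. -/

section TraceClass

open ContinuousLinearMap

variable {K : Type*} [NormedAddCommGroup K] [InnerProductSpace ℂ K]
  {ι : Type*} (b : HilbertBasis ι ℂ K)

/-! ### Hilbert–Schmidt sums, polar decomposition and trace class operators. -/

/-- The square of the Hilbert–Schmidt norm. -/
noncomputable def hsSq (X : K →L[ℂ] K) : ℝ≥0∞ := ∑' i, ‖X (b i)‖ₑ ^ 2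

theorem enorm_sq_eq_tsum (x : K) : ‖x‖ₑ ^ 2 = ∑' i, ‖⟪b i, x⟫_ℂ‖ₑ ^ 2 := by
  have h := ofReal_norm_sq_eq_tsum b x
  simpa only [ENNReal.ofReal_pow (norm_nonneg _), ofReal_norm] using h

theorem enorm_inner_symm (x y : K) : ‖⟪x, y⟫_ℂ‖ₑ = ‖⟪y, x⟫_ℂ‖ₑ := by
  rw [← ofReal_norm, norm_inner_symm, ofReal_norm]

theorem enorm_inner_le (x y : K) : ‖⟪x, y⟫_ℂ‖ₑ ≤ ‖x‖ₑ * ‖y‖ₑ := by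
  rw [← ofReal_norm, ← ofReal_norm, ← ofReal_norm, ← ENNReal.ofReal_mul (norm_nonneg _)]
  exact ENNReal.ofReal_le_ofReal (norm_inner_le_norm x y)

/-- The missing factor 1/2 is harmless: the sums bounded this way only have to be finite, uniformly
in σ. -/
theorem ENNReal.mul_le_sq_add_sq (x y : ℝ≥0∞) : x * y ≤ x ^ 2 + y ^ 2 := by
  rcases le_total x y with h | h
  · calc x * y ≤ y * y := by gcongr
      _ = y ^ 2 := (sq y).symm
      _ ≤ _ := le_add_self
  · calc x * y ≤ x * x := by gcongr
      _ = x ^ 2 := (sq x).symm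
      _ ≤ _ := le_self_add

theorem hsSq_comp_le (Y X : K →L[ℂ] K) : hsSq b (Y ∘L X) ≤ ‖Y‖ₑ ^ 2 * hsSq b X := by
  rw [hsSq, hsSq, ← ENNReal.tsum_mul_left]
  refine ENNReal.tsum_le_tsum fun i => ?_
  rw [← mul_pow]
  gcongr
  exact le_opENorm Y _

theorem tsum_enorm_inner_le (V W : K →L[ℂ] K) :
    ∑' i, ‖⟪V (b i), W (b i)⟫_ℂ‖ₑ ≤ hsSq b V + hsSq b W := by
  rw [hsSq, hsSq, ← ENNReal.tsum_add]
  exact ENNReal.tsum_le_tsum fun i => (enorm_inner_le _ _).trans (ENNReal.mul_le_sq_add_sq _ _)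

theorem summable_norm_of_tsum_enorm {ι E : Type*} [NormedAddCommGroup E] {f : ι → E}
    (h : ∑' i, ‖f i‖ₑ ≠ ⊤) : Summable fun i => ‖f i‖ := by
  have := ENNReal.summable_toReal h
  simpa using this

variable [CompleteSpace K]

theorem norm_abs_apply (T : K →L[ℂ] K) (x : K) : ‖CFC.abs T x‖ = ‖T x‖ := by
  have hs : star (CFC.abs T) = CFC.abs T :=
    (IsSelfAdjoint.of_nonneg (CFC.abs_nonneg T)).star_eq
  have h1 : ⟪CFC.abs T x, CFC.abs T x⟫_ℂ = ⟪T x, T x⟫_ℂ := by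
    rw [← adjoint_inner_right, ← star_eq_adjoint, hs, ← mul_apply_eq_comp, CFC.abs_mul_abs,
      mul_apply_eq_comp, star_eq_adjoint, adjoint_inner_right]
  rw [inner_self_eq_norm_sq_to_K, inner_self_eq_norm_sq_to_K] at h1
  have h2 : ‖CFC.abs T x‖ ^ 2 = ‖T x‖ ^ 2 := by exact_mod_cast h1
  exact (pow_left_inj₀ (norm_nonneg _) (norm_nonneg _) two_ne_zero).1 h2

/-- A contraction `U` that maps `R x` to `T x`, when `‖T x‖ = ‖R x‖` for all `x`. -/
theorem exists_contraction_comp_eq (T R : K →L[ℂ] K) (h : ∀ x, ‖T x‖ = ‖R x‖) :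
    ∃ U : K →L[ℂ] K, ‖U‖ ≤ 1 ∧ T = U ∘L R := by
  let N : Submodule ℂ K := R.range.topologicalClosure
  have : CompleteSpace N :=
    (Submodule.isClosed_topologicalClosure _).completeSpace_coe
  have hmem : ∀ x, (R : K →ₗ[ℂ] K) x ∈ N := fun x =>
    Submodule.le_topologicalClosure _ ⟨x, rfl⟩
  let e : K →ₗ[ℂ] N := (R : K →ₗ[ℂ] K).codRestrict N hmem
  have he : DenseRange e := by
    intro y
    rw [Metric.mem_closure_iff]
    intro ε hε
    obtain ⟨_, ⟨x, rfl⟩, hx⟩ := Metric.mem_closure_iff.1 y.2 ε hε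
    exact ⟨e x, ⟨x, rfl⟩, hx⟩
  have hb : ∀ x, ‖(T : K →ₗ[ℂ] K) x‖ ≤ 1 * ‖e x‖ := fun x => by
    rw [one_mul]; exact (h x).le
  -- R x ↦ T x is well defined and isometric on the range of R; it extends to the closure N by
  -- density and to K by zero on the orthogonal complement.
  let g : N →L[ℂ] K := (T : K →ₗ[ℂ] K).extendOfNorm e
  refine ⟨g ∘L N.orthogonalProjectionOnto, ?_, ?_⟩
  · refine (opNorm_comp_le _ _).trans ?_
    have h1 : ‖g‖ ≤ 1 := LinearMap.opNorm_extendOfNorm_le he zero_le_one hb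
    exact mul_le_one₀ h1 (norm_nonneg _) (Submodule.orthogonalProjectionOnto_norm_le _)
  · ext x
    have h1 : N.orthogonalProjectionOnto (R x) = e x :=
      Submodule.orthogonalProjectionOnto_mem_subspace_eq_self (e x)
    rw [comp_apply, comp_apply, h1]
    exact (LinearMap.extendOfNorm_eq he ⟨1, hb⟩ x).symm

/-- A weak polar decomposition. -/
theorem exists_polar (T : K →L[ℂ] K) :
    ∃ U : K →L[ℂ] K, ‖U‖ ≤ 1 ∧ T = U ∘L CFC.abs T ∧ CFC.abs T = adjoint U ∘L T := by
  obtain ⟨U, hU, hT⟩ := exists_contraction_comp_eq T (CFC.abs T) fun x => (norm_abs_apply T x).symm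
  refine ⟨U, hU, hT, ?_⟩
  ext x
  have hTx : T x = U (CFC.abs T x) := by
    conv_lhs => rw [hT]
    rfl
  -- U need not be a partial isometry here, so U*T = |T| comes from the equality case: ‖U*Tx −
  -- |T|x‖² = ‖U*Tx‖² − 2‖Tx‖² + ‖Tx‖² ≤ 0.
  have hU' : ‖adjoint U (T x)‖ ≤ ‖T x‖ := by
    refine (le_opNorm _ _).trans ?_
    rw [LinearIsometryEquiv.norm_map]
    exact mul_le_of_le_one_left (norm_nonneg _) hU
  have hre : (⟪adjoint U (T x), CFC.abs T x⟫_ℂ).re = ‖T x‖ ^ 2 := by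
    rw [adjoint_inner_left, ← hTx]
    exact inner_self_eq_norm_sq (𝕜 := ℂ) _
  have hsq := norm_sub_sq (𝕜 := ℂ) (adjoint U (T x)) (CFC.abs T x)
  rw [norm_abs_apply] at hsq
  have hre' : RCLike.re ⟪adjoint U (T x), CFC.abs T x⟫_ℂ = ‖T x‖ ^ 2 := hre
  rw [hre'] at hsq
  have hz : ‖adjoint U (T x) - CFC.abs T x‖ ^ 2 ≤ 0 := by
    rw [hsq]
    nlinarith [norm_nonneg (adjoint U (T x)), norm_nonneg (T x)]
  have hz' : ‖adjoint U (T x) - CFC.abs T x‖ = 0 :=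
    pow_eq_zero_iff two_ne_zero |>.1 (le_antisymm hz (by positivity))
  exact (sub_eq_zero.1 (norm_eq_zero.1 hz')).symm

/-- By Parseval both sides are the double sum of the squared moduli of the matrix coefficients of X,
summed in opposite orders. -/
theorem hsSq_adjoint (X : K →L[ℂ] K) : hsSq b (adjoint X) = hsSq b X := by
  simp_rw [hsSq, enorm_sq_eq_tsum b (adjoint X _), enorm_sq_eq_tsum b (X _)]
  rw [ENNReal.tsum_comm]
  refine tsum_congr fun i => tsum_congr fun j => ?_
  rw [adjoint_inner_right, enorm_inner_symm]

theorem enorm_adjoint (X : K →L[ℂ] K) : ‖adjoint X‖ₑ = ‖X‖ₑ := by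
  rw [← ofReal_norm, ← ofReal_norm, LinearIsometryEquiv.norm_map]

theorem hsSq_comp_le' (X Y : K →L[ℂ] K) : hsSq b (X ∘L Y) ≤ ‖Y‖ₑ ^ 2 * hsSq b X := by
  rw [← hsSq_adjoint, adjoint_comp]
  refine (hsSq_comp_le b _ _).trans ?_
  rw [hsSq_adjoint, enorm_adjoint]

/-- Parseval for X x, with Cauchy–Schwarz applied to each coefficient ⟨X* b_i, x⟩. -/
theorem enorm_sq_le_hsSq (X : K →L[ℂ] K) (x : K) : ‖X x‖ₑ ^ 2 ≤ hsSq b X * ‖x‖ₑ ^ 2 := by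
  rw [← hsSq_adjoint, hsSq, enorm_sq_eq_tsum b, ← ENNReal.tsum_mul_right]
  refine ENNReal.tsum_le_tsum fun i => ?_
  rw [← mul_pow, ← adjoint_inner_left]
  gcongr
  exact enorm_inner_le _ _

/-- This is Tr(V*W) = Tr(WV*). Parseval turns each side into an iterated sum, and the
Hilbert–Schmidt bounds make the double series absolutely summable. -/
theorem tsum_inner_comm {V W : K →L[ℂ] K} (hV : hsSq b V ≠ ⊤) (hW : hsSq b W ≠ ⊤) :
    ∑' i, ⟪V (b i), W (b i)⟫_ℂ = ∑' j, ⟪adjoint W (b j), adjoint V (b j)⟫_ℂ := by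
  have hsum : Summable (Function.uncurry fun i j => ⟪V (b i), b j⟫_ℂ * ⟪b j, W (b i)⟫_ℂ) := by
    suffices h : ∑' p : ι × ι, ‖⟪V (b p.1), b p.2⟫_ℂ * ⟪b p.2, W (b p.1)⟫_ℂ‖ₑ < ⊤ from
      Summable.of_norm (summable_norm_of_tsum_enorm h.ne)
    rw [ENNReal.tsum_prod']
    calc ∑' i, ∑' j, ‖⟪V (b i), b j⟫_ℂ * ⟪b j, W (b i)⟫_ℂ‖ₑ
        ≤ ∑' i, (‖V (b i)‖ₑ ^ 2 + ‖W (b i)‖ₑ ^ 2) := by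
          refine ENNReal.tsum_le_tsum fun i => ?_
          rw [enorm_sq_eq_tsum b (V (b i)), enorm_sq_eq_tsum b (W (b i)), ← ENNReal.tsum_add]
          refine ENNReal.tsum_le_tsum fun j => ?_
          rw [enorm_mul, enorm_inner_symm (V (b i))]
          exact ENNReal.mul_le_sq_add_sq _ _
      _ = hsSq b V + hsSq b W := ENNReal.tsum_add
      _ < ⊤ := ENNReal.add_lt_top.2 ⟨hV.lt_top, hW.lt_top⟩
  calc ∑' i, ⟪V (b i), W (b i)⟫_ℂ = ∑' i, ∑' j, ⟪V (b i), b j⟫_ℂ * ⟪b j, W (b i)⟫_ℂ :=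
        tsum_congr fun i => (b.tsum_inner_mul_inner _ _).symm
    _ = ∑' j, ∑' i, ⟪V (b i), b j⟫_ℂ * ⟪b j, W (b i)⟫_ℂ := hsum.tsum_comm.symm
    _ = _ := by
        refine tsum_congr fun j => ?_
        rw [← b.tsum_inner_mul_inner]
        refine tsum_congr fun i => ?_
        rw [adjoint_inner_left, adjoint_inner_right, mul_comm]

/-- `tsum_inner_comm` for (XV)* and WY. On the right X and Y enter only through the product YX,
between vectors independent of both; this serves cyclicity as well as weak continuity. -/
theorem tsum_inner_comp_comm {V W : K →L[ℂ] K} (hV : hsSq b V ≠ ⊤) (hW : hsSq b W ≠ ⊤)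
    (X Y : K →L[ℂ] K) :
    ∑' i, ⟪b i, X (V (W (Y (b i))))⟫_ℂ = ∑' j, ⟪adjoint W (b j), Y (X (V (b j)))⟫_ℂ := by
  have hV' : hsSq b (adjoint (X ∘L V)) ≠ ⊤ := by
    rw [hsSq_adjoint]
    exact ne_top_of_le_ne_top (ENNReal.mul_ne_top (by simp) hV) (hsSq_comp_le b X V)
  have hW' : hsSq b (W ∘L Y) ≠ ⊤ :=
    ne_top_of_le_ne_top (ENNReal.mul_ne_top (by simp) hW) (hsSq_comp_le' b W Y)
  have h := tsum_inner_comm b hV' hW'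
  simp only [adjoint_adjoint, adjoint_comp, comp_apply, adjoint_inner_left] at h
  simpa only [adjoint_inner_left] using h

/-- A trace class operator is a product of two Hilbert–Schmidt operators. -/
theorem exists_hsSq_factorization (A : K →L[ℂ] K) :
    ∃ V W : K →L[ℂ] K, A = V ∘L W ∧ hsSq (onb K) V ≤ traceNorm A ∧
      hsSq (onb K) W ≤ traceNorm A := by
  obtain ⟨U, hU, hA, -⟩ := exists_polar A
  set R : K →L[ℂ] K := CFC.sqrt (CFC.abs A) with hR
  have hRR : R * R = CFC.abs A := CFC.sqrt_mul_sqrt_self _ (CFC.abs_nonneg A)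
  have hRs : star R = R := (IsSelfAdjoint.of_nonneg (CFC.sqrt_nonneg _)).star_eq
  have hhs : hsSq (onb K) R = traceNorm A := by
    rw [hsSq, traceNorm]
    refine tsum_congr fun i => ?_
    rw [← ofReal_norm, ← ENNReal.ofReal_pow (norm_nonneg _), ← hRR, mul_apply_eq_comp,
      ← adjoint_inner_left, ← star_eq_adjoint, hRs]
    congr 1
    exact (inner_self_eq_norm_sq (𝕜 := ℂ) _).symm
  refine ⟨U ∘L R, R, ?_, ?_, hhs.le⟩
  · conv_lhs => rw [hA, ← hRR]
    rfl
  · refine (hsSq_comp_le _ U R).trans ?_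
    rw [hhs]
    refine mul_le_of_le_one_left' (pow_le_one' ?_ 2)
    rw [← ofReal_norm]
    exact ENNReal.ofReal_le_one.2 hU

/-- With A = VW each term pairs (XV)*e with WYe, and both operators are Hilbert–Schmidt when A is of
trace class. -/
theorem tsum_enorm_inner_le_traceNorm (A X Y : K →L[ℂ] K) :
    ∑' i, ‖⟪onb K i, X (A (Y (onb K i)))⟫_ℂ‖ₑ ≤ (‖X‖ₑ ^ 2 + ‖Y‖ₑ ^ 2) * traceNorm A := by
  obtain ⟨V, W, hA, hV, hW⟩ := exists_hsSq_factorization A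
  calc ∑' i, ‖⟪onb K i, X (A (Y (onb K i)))⟫_ℂ‖ₑ
      = ∑' i, ‖⟪adjoint (X ∘L V) (onb K i), (W ∘L Y) (onb K i)⟫_ℂ‖ₑ := by
        refine tsum_congr fun i => ?_
        rw [adjoint_inner_left, hA]
        rfl
    _ ≤ hsSq (onb K) (adjoint (X ∘L V)) + hsSq (onb K) (W ∘L Y) := tsum_enorm_inner_le _ _ _
    _ ≤ ‖X‖ₑ ^ 2 * traceNorm A + ‖Y‖ₑ ^ 2 * traceNorm A := by
        rw [hsSq_adjoint]
        gcongr
        · exact (hsSq_comp_le _ X V).trans (by gcongr)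
        · exact (hsSq_comp_le' _ W Y).trans (by gcongr)
    _ = _ := (add_mul _ _ _).symm

/-- The operator norm is at most the Hilbert–Schmidt norm, for each factor of A = VW. -/
theorem enorm_apply_le_traceNorm (A : K →L[ℂ] K) (x : K) : ‖A x‖ₑ ≤ traceNorm A * ‖x‖ₑ := by
  obtain ⟨V, W, hA, hV, hW⟩ := exists_hsSq_factorization A
  refine (ENNReal.pow_le_pow_left_iff two_ne_zero).1 ?_
  calc ‖A x‖ₑ ^ 2 = ‖V (W x)‖ₑ ^ 2 := by rw [hA]; rfl
    _ ≤ hsSq (onb K) V * (hsSq (onb K) W * ‖x‖ₑ ^ 2) :=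
        (enorm_sq_le_hsSq (onb K) V _).trans (by gcongr; exact enorm_sq_le_hsSq (onb K) W _)
    _ ≤ traceNorm A * (traceNorm A * ‖x‖ₑ ^ 2) := by gcongr
    _ = _ := by ring

/-- Since |T| = U*T for a contraction U, the partial sums of the trace norm are themselves sums of
the given kind. Only finite J occur, so that T may be a Pettis integral and the sum may be taken
inside it. -/
theorem traceNorm_le_of_forall_contraction (T : K →L[ℂ] K) (M : ℝ≥0∞)
    (h : ∀ U : K →L[ℂ] K, ‖U‖ ≤ 1 → ∀ J : Finset (basisSet K),
      ‖∑ i ∈ J, ⟪U (onb K i), T (onb K i)⟫_ℂ‖ₑ ≤ M) :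
    traceNorm T ≤ M := by
  obtain ⟨U, hU, -, hT⟩ := exists_polar T
  have hin : ∀ i, ⟪onb K i, CFC.abs T (onb K i)⟫_ℂ = ⟪U (onb K i), T (onb K i)⟫_ℂ := fun i => by
    rw [hT, comp_apply, adjoint_inner_right]
  rw [traceNorm, ENNReal.tsum_eq_iSup_sum]
  refine iSup_le fun J => ?_
  have hpos : ∀ i, 0 ≤ (⟪onb K i, CFC.abs T (onb K i)⟫_ℂ).re := fun i =>
    ((nonneg_iff_isPositive _).1 (CFC.abs_nonneg T)).re_inner_nonneg_right _
  rw [← ENNReal.ofReal_sum_of_nonneg fun i _ => hpos i, ← Complex.re_sum]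
  refine (ENNReal.ofReal_le_ofReal (Complex.re_le_norm _)).trans ?_
  rw [ofReal_norm]
  simpa only [hin] using h U hU J

theorem IsTraceClass.summable {T : K →L[ℂ] K} (hT : IsTraceClass T) :
    Summable fun i => ⟪onb K i, T (onb K i)⟫_ℂ := by
  refine (summable_norm_of_tsum_enorm (ne_top_of_le_ne_top ?_
    (tsum_enorm_inner_le_traceNorm T (.id ℂ K) (.id ℂ K)))).of_norm
  exact ENNReal.mul_ne_top (by simp) hT.ne

/-- If A = VW, a basis vector not killed by A is not killed by W, and a finite sum ∑‖We‖² has only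
countably many nonzero terms. -/
theorem IsTraceClass.countable_support {T : K →L[ℂ] K} (hT : IsTraceClass T) :
    {i | T (onb K i) ≠ 0}.Countable := by
  obtain ⟨V, W, hA, -, hW⟩ := exists_hsSq_factorization T
  have h : hsSq (onb K) W ≠ ⊤ := ne_top_of_le_ne_top hT.ne hW
  refine (Summable.countable_support_ennreal h).mono fun i hi => ?_
  contrapose! hi
  have : W (onb K i) = 0 := by simpa using hi
  simp [hA, this]

/-- With T = VW both traces equal ∑ⱼ⟨XVeⱼ, W*eⱼ⟩. -/
theorem IsTraceClass.opTrace_comp_comm {T : K →L[ℂ] K} (hT : IsTraceClass T) (X : K →L[ℂ] K) :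
    opTrace (T ∘L X) = opTrace (X ∘L T) := by
  obtain ⟨V, W, hA, hV, hW⟩ := exists_hsSq_factorization T
  have hV' := ne_top_of_le_ne_top hT.ne hV
  have hW' := ne_top_of_le_ne_top hT.ne hW
  have h1 := tsum_inner_comp_comm (onb K) hV' hW' (.id ℂ K) X
  have h2 := tsum_inner_comp_comm (onb K) hV' hW' X (.id ℂ K)
  rw [hA, opTrace, opTrace]
  exact h1.trans h2.symm

/-- `X ↦ Tr (A X)` is weakly continuous on bounded sequences. -/
theorem tendsto_tsum_inner_comp {A : K →L[ℂ] K} (hA : IsTraceClass A) {X Y : ℕ → K →L[ℂ] K}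
    {X' Y' : K →L[ℂ] K} {D : ℝ} (hD : ∀ n, ‖Y n ∘L X n‖ ≤ D)
    (hlim : ∀ h k, Tendsto (fun n => ⟪k, Y n (X n h)⟫_ℂ) atTop (𝓝 ⟪k, Y' (X' h)⟫_ℂ)) :
    Tendsto (fun n => ∑' i, ⟪onb K i, X n (A (Y n (onb K i)))⟫_ℂ) atTop
      (𝓝 (∑' i, ⟪onb K i, X' (A (Y' (onb K i)))⟫_ℂ)) := by
  obtain ⟨V, W, hA', hV, hW⟩ := exists_hsSq_factorization A
  have hV' := ne_top_of_le_ne_top hA.ne hV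
  have hW' := ne_top_of_le_ne_top hA.ne hW
  have hWa : hsSq (onb K) (adjoint W) ≠ ⊤ := by rwa [hsSq_adjoint]
  have hsumm : ∀ {Z : K →L[ℂ] K}, hsSq (onb K) Z ≠ ⊤ → Summable fun i => ‖Z (onb K i)‖ ^ 2 := by
    intro Z hZ
    have := ENNReal.summable_toReal hZ
    simpa using this
  -- After this rotation n enters only through the weak coefficients of Yₙ Xₙ at the fixed vectors V
  -- eⱼ and W* eⱼ, whose squared norms are summable.
  simp only [hA', comp_apply, tsum_inner_comp_comm (onb K) hV' hW']
  refine tendsto_tsum_of_dominated_convergence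
    (((hsumm hWa).add (hsumm hV')).mul_left D) (fun j => hlim _ _)
    (Eventually.of_forall fun n j => ?_)
  have hD0 : 0 ≤ D := (norm_nonneg _).trans (hD 0)
  have h1 : ‖Y n (X n (V (onb K j)))‖ ≤ D * ‖V (onb K j)‖ :=
    ((Y n ∘L X n).le_opNorm _).trans (by gcongr; exact hD n)
  calc ‖⟪adjoint W (onb K j), Y n (X n (V (onb K j)))⟫_ℂ‖
      ≤ ‖adjoint W (onb K j)‖ * (D * ‖V (onb K j)‖) :=
        (norm_inner_le_norm _ _).trans (by gcongr)
    _ = D * (‖adjoint W (onb K j)‖ * ‖V (onb K j)‖) := by ring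
    _ ≤ _ := by
        gcongr
        nlinarith [sq_nonneg (‖adjoint W (onb K j)‖ - ‖V (onb K j)‖),
          sq_nonneg (‖adjoint W (onb K j)‖), sq_nonneg (‖V (onb K j)‖)]

open Classical in
/-- The orthogonal projection onto the closed span of a set of basis vectors. -/
theorem exists_basis_projection (J : Set ι) :
    ∃ P : K →L[ℂ] K, ∀ i, P (b i) = if i ∈ J then b i else 0 := by
  let N : Submodule ℂ K := (Submodule.span ℂ (b '' J)).topologicalClosure
  have : CompleteSpace N :=
    (Submodule.isClosed_topologicalClosure _).completeSpace_coe
  refine ⟨N.starProjection, fun i => ?_⟩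
  split_ifs with hi
  · exact Submodule.starProjection_eq_self_iff.2
      (Submodule.le_topologicalClosure _ (Submodule.subset_span ⟨i, hi, rfl⟩))
  · rw [Submodule.starProjection_apply_eq_zero_iff, Submodule.orthogonal_closure,
      Submodule.mem_orthogonal]
    intro u hu
    induction hu using Submodule.span_induction with
    | mem x hx =>
      obtain ⟨j, hj, rfl⟩ := hx
      exact b.orthonormal.2 (by rintro rfl; exact hi hj)
    | zero => simp
    | add x y _ _ hx hy => simp [inner_add_left, hx, hy]
    | smul c x _ hx => simp [inner_smul_left, hx]

end TraceClass

/-! ### Traces of Pettis integrals. -/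

section PettisTrace

variable {S K : Type*} [NormedAddCommGroup K] [InnerProductSpace ℂ K] [CompleteSpace K]

/-- The sums `∑ₑ |⟨F(σ) e, U e⟩|` are bounded by `M`, uniformly in `σ` and in contractions `U`. -/
def TraceBoundedBy (F : S → K →L[ℂ] K) (M : ℝ≥0∞) : Prop :=
  ∀ σ, ∀ U : K →L[ℂ] K, ‖U‖ ≤ 1 → ∑' i, ‖⟪U (onb K i), F σ (onb K i)⟫_ℂ‖ₑ ≤ M

variable {F : S → K →L[ℂ] K} {M : ℝ≥0∞}

theorem TraceBoundedBy.tsum_subtype_le (hM : TraceBoundedBy F M) (J : Set (basisSet K)) (σ : S) :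
    ∑' i : J, ‖⟪onb K i, F σ (onb K i)⟫_ℂ‖ₑ ≤ M :=
  (ENNReal.tsum_comp_le_tsum_of_injective Subtype.val_injective
    fun i => ‖⟪onb K i, F σ (onb K i)⟫_ℂ‖ₑ).trans
    (hM σ (.id ℂ K) ContinuousLinearMap.norm_id_le)

theorem TraceBoundedBy.norm_tsum_subtype_le (hM : TraceBoundedBy F M) (hM' : M ≠ ⊤)
    (J : Set (basisSet K)) (σ : S) :
    ‖∑' i : J, ⟪onb K i, F σ (onb K i)⟫_ℂ‖ ≤ M.toReal := by
  rw [← toReal_enorm]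
  exact ENNReal.toReal_mono hM' (enorm_tsum_le_tsum_enorm.trans (hM.tsum_subtype_le J σ))

variable [MeasurableSpace S] {ρ : Measure S}

/-- For countable J the filter of finite subsets is countably generated, so the sum is a limit of
measurable functions. For uncountable J measurability may fail. -/
theorem PointwiseWeaklyMeasurable.measurable_tsum_subtype (hF : PointwiseWeaklyMeasurable F)
    (hM : TraceBoundedBy F M) (hM' : M ≠ ⊤) {J : Set (basisSet K)} (hJ : J.Countable) :
    Measurable fun σ => ∑' i : J, ⟪onb K i, F σ (onb K i)⟫_ℂ := by
  have := hJ.to_subtype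
  have hs : ∀ σ, Summable fun i : J => ⟪onb K i, F σ (onb K i)⟫_ℂ := fun σ =>
    (summable_norm_of_tsum_enorm
      (ne_top_of_le_ne_top hM' (hM.tsum_subtype_le J σ))).of_norm
  refine measurable_of_tendsto_metrizable' (atTop : Filter (Finset J))
    (f := fun (s : Finset J) σ => ∑ i ∈ s, ⟪onb K i, F σ (onb K i)⟫_ℂ)
    (fun s => Finset.measurable_sum s fun i _ => hF _ _) ?_
  rw [tendsto_pi_nhds]
  exact fun σ => (hs σ).hasSum

variable [IsFiniteMeasure ρ]

theorem PointwisePettisIntegrable.isTraceClass_pettisIntegral (hF : PointwisePettisIntegrable F ρ)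
    (hM : TraceBoundedBy F M) (hM' : M ≠ ⊤) : IsTraceClass (pettisIntegral F ρ) := by
  refine (traceNorm_le_of_forall_contraction _ (M * ρ Set.univ) fun U hU J => ?_).trans_lt
    (ENNReal.mul_lt_top hM'.lt_top (measure_lt_top _ _))
  simp only [hF.inner_pettisIntegral]
  rw [← integral_finsetSum _ fun i _ => hF.2 _ _]
  calc ‖∫ σ, ∑ i ∈ J, ⟪U (onb K i), F σ (onb K i)⟫_ℂ ∂ρ‖ₑ
      ≤ ∫⁻ σ, ‖∑ i ∈ J, ⟪U (onb K i), F σ (onb K i)⟫_ℂ‖ₑ ∂ρ := enorm_integral_le_lintegral_enorm _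
    _ ≤ ∫⁻ _, M ∂ρ := by
        refine lintegral_mono fun σ => (enorm_sum_le _ _).trans ?_
        exact (ENNReal.sum_le_tsum J).trans (hM σ U hU)
    _ = M * ρ Set.univ := lintegral_const _

/-- Basis vectors outside J are invisible to the integral but not necessarily to the single F(σ);
hence the integrand is the sum over J, not the full trace. Countability of J permits the exchange of
sum and integral. -/
theorem PointwisePettisIntegrable.opTrace_pettisIntegral (hF : PointwisePettisIntegrable F ρ)
    (hM : TraceBoundedBy F M) (hM' : M ≠ ⊤) {J : Set (basisSet K)} (hJ : J.Countable)
    (hFJ : ∀ i ∉ J, pettisIntegral F ρ (onb K i) = 0) :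
    opTrace (pettisIntegral F ρ) = ∫ σ, ∑' i : J, ⟪onb K i, F σ (onb K i)⟫_ℂ ∂ρ := by
  have := hJ.to_subtype
  rw [integral_tsum (fun i => (hF.2 _ _).aestronglyMeasurable)]
  · simp only [← hF.inner_pettisIntegral]
    refine (tsum_subtype_eq_of_support_subset
      (f := fun i => ⟪onb K i, pettisIntegral F ρ (onb K i)⟫_ℂ) fun i hi => ?_).symm
    by_contra hiJ
    exact hi (by simp [hFJ i hiJ])
  · rw [← lintegral_tsum fun i => (hF.2 _ _).aestronglyMeasurable.enorm]
    refine ne_top_of_le_ne_top (ENNReal.mul_ne_top hM' (measure_ne_top ρ Set.univ)) ?_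
    rw [← lintegral_const]
    exact lintegral_mono fun σ => hM.tsum_subtype_le J σ

/-- The trace of the integral is continuous under bounded pointwise limits, although it need not be
the integral of the trace. -/
theorem tendsto_opTrace_pettisIntegral {F : ℕ → S → K →L[ℂ] K} {F' : S → K →L[ℂ] K}
    (hF : ∀ n, PointwisePettisIntegrable (F n) ρ) (hF' : PointwisePettisIntegrable F' ρ)
    (hFM : ∀ n, TraceBoundedBy (F n) M) (hFM' : TraceBoundedBy F' M) (hM : M ≠ ⊤)
    (hlim : ∀ σ, ∀ P : K →L[ℂ] K, Tendsto (fun n => ∑' i, ⟪P (onb K i), F n σ (onb K i)⟫_ℂ) atTop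
      (𝓝 (∑' i, ⟪P (onb K i), F' σ (onb K i)⟫_ℂ))) :
    Tendsto (fun n => opTrace (pettisIntegral (F n) ρ)) atTop
      (𝓝 (opTrace (pettisIntegral F' ρ))) := by
  classical
  -- One countable set for all n and the limit, so that the integrands are sums over the same index
  -- set.
  let J : Set (basisSet K) := (⋃ n, {i | pettisIntegral (F n) ρ (onb K i) ≠ 0}) ∪
    {i | pettisIntegral F' ρ (onb K i) ≠ 0}
  have hJ : J.Countable :=
    (Set.countable_iUnion fun n =>
      ((hF n).isTraceClass_pettisIntegral (hFM n) hM).countable_support).union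
      (hF'.isTraceClass_pettisIntegral hFM' hM).countable_support
  have h1 : ∀ n, ∀ i ∉ J, pettisIntegral (F n) ρ (onb K i) = 0 := fun n i hi => by
    by_contra h
    exact hi (Or.inl (Set.mem_iUnion.2 ⟨n, h⟩))
  have h2 : ∀ i ∉ J, pettisIntegral F' ρ (onb K i) = 0 := fun i hi => by
    by_contra h
    exact hi (Or.inr h)
  -- Inserting P turns the sum over J into a full sum twisted by a bounded operator, which `hlim`
  -- controls.
  obtain ⟨P, hP⟩ := exists_basis_projection (onb K) J
  have hsub : ∀ T : K →L[ℂ] K,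
      ∑' i : J, ⟪onb K i, T (onb K i)⟫_ℂ = ∑' i, ⟪P (onb K i), T (onb K i)⟫_ℂ := fun T => by
    rw [tsum_subtype J fun i => ⟪onb K i, T (onb K i)⟫_ℂ]
    refine tsum_congr fun i => ?_
    by_cases hi : i ∈ J <;> simp [hP, hi]
  simp only [fun n => (hF n).opTrace_pettisIntegral (hFM n) hM hJ (h1 n),
    hF'.opTrace_pettisIntegral hFM' hM hJ h2]
  refine tendsto_integral_of_dominated_convergence (fun _ => M.toReal)
    (fun n => ((hF n).1.measurable_tsum_subtype (hFM n) hM hJ).aestronglyMeasurable)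
    (integrable_const _)
    (fun n => Eventually.of_forall fun σ => (hFM n).norm_tsum_subtype_le hM J σ)
    (Eventually.of_forall fun σ => ?_)
  simp only [hsub]
  exact hlim σ P

end PettisTrace

/-! ### Monotone class induction. -/

/-- Induction principle for bounded measurable functions, starting from the indicators of a
generating π-system. -/
theorem bounded_measurable_induction {α : Type*} {mα : MeasurableSpace α} {C : Set (Set α)}
    (hgen : mα = MeasurableSpace.generateFrom C) (hpi : IsPiSystem C) (P : (α → ℂ) → Prop)
    (one : P (Set.univ.indicator fun _ => 1))
    (basic : ∀ s ∈ C, P (s.indicator fun _ => 1))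
    (smul : ∀ (c : ℂ) f, Measurable f → (∃ D : ℝ, ∀ x, ‖f x‖ ≤ D) → P f → P (c • f))
    (add : ∀ f g, Measurable f → (∃ D : ℝ, ∀ x, ‖f x‖ ≤ D) → Measurable g →
      (∃ D : ℝ, ∀ x, ‖g x‖ ≤ D) → P f → P g → P (f + g))
    (lim : ∀ (u : ℕ → α → ℂ) f (D : ℝ), (∀ n, Measurable (u n)) → (∀ n x, ‖u n x‖ ≤ D) →
      Measurable f → (∀ x, ‖f x‖ ≤ D) →
      (∀ x, Tendsto (fun n => u n x) atTop (𝓝 (f x))) → (∀ n, P (u n)) → P f)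
    {f : α → ℂ} (hf : Measurable f) (hfb : ∃ D : ℝ, ∀ x, ‖f x‖ ≤ D) : P f := by
  have hmeas : ∀ {s : Set α}, MeasurableSet s → Measurable (s.indicator fun _ => (1 : ℂ)) :=
    fun hs => measurable_const.indicator hs
  have hnorm : ∀ (s : Set α) x, ‖s.indicator (fun _ => (1 : ℂ)) x‖ ≤ 1 := fun s x =>
    (norm_indicator_le_norm_self _ _).trans (by simp)
  have hbdd : ∀ (s : Set α), ∃ D : ℝ, ∀ x, ‖s.indicator (fun _ => (1 : ℂ)) x‖ ≤ D :=
    fun s => ⟨1, hnorm s⟩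
  have zero : P 0 := by
    simpa using smul 0 _ (hmeas .univ) (hbdd _) one
  have hset : ∀ s, MeasurableSet s → P (s.indicator fun _ => 1) := by
    refine MeasurableSpace.induction_on_inter hgen hpi ?_ basic ?_ ?_
    · simpa using! zero
    · intro s hs h
      have h1 : sᶜ.indicator (fun _ => (1 : ℂ)) = Set.univ.indicator (fun _ => 1)
          + (-1 : ℂ) • s.indicator fun _ => (1 : ℂ) := by
        ext x
        by_cases hx : x ∈ s <;> simp [hx]
      rw [h1]
      refine add _ _ (hmeas .univ) (hbdd _) ((hmeas hs).const_smul _) ⟨1, fun x => ?_⟩ one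
        (smul _ _ (hmeas hs) (hbdd _) h)
      simpa using hnorm s x
    · intro g hd hg h
      -- A countable disjoint union is reached through finite unions, whose indicators converge
      -- pointwise and are bounded by 1.
      have hfin : ∀ n, P ((⋃ i ∈ Finset.range n, g i).indicator fun _ => 1) := by
        intro n
        induction n with
        | zero => simpa using! zero
        | succ n ih =>
          have h1 : (⋃ i ∈ Finset.range (n + 1), g i).indicator (fun _ => (1 : ℂ)) =
              (g n).indicator (fun _ => 1) +
                (⋃ i ∈ Finset.range n, g i).indicator fun _ => (1 : ℂ) := by
            rw [Finset.range_add_one, Finset.set_biUnion_insert]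
            refine Set.indicator_union_of_disjoint ?_ _
            rw [Set.disjoint_iUnion₂_right]
            intro i hi
            exact hd (Finset.mem_range.1 hi).ne'
          rw [h1]
          exact add _ _ (hmeas (hg n)) (hbdd _)
            (hmeas (Finset.measurableSet_biUnion _ fun i _ => hg i)) (hbdd _) (h n) ih
      refine lim _ _ 1 (fun n => hmeas (Finset.measurableSet_biUnion _ fun i _ => hg i))
        (fun n => hnorm _) (hmeas (.iUnion hg)) (hnorm _) (fun x => ?_) hfin
      refine tendsto_const_nhds.congr' ?_
      by_cases hx : x ∈ ⋃ i, g i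
      · obtain ⟨i, hi⟩ := Set.mem_iUnion.1 hx
        filter_upwards [eventually_gt_atTop i] with n hn
        rw [Set.indicator_of_mem hx, Set.indicator_of_mem]
        exact Set.mem_biUnion (Finset.mem_coe.2 (Finset.mem_range.2 hn)) hi
      · refine Eventually.of_forall fun n => ?_
        refine (Set.indicator_of_notMem hx _).trans (Set.indicator_of_notMem (fun h' => ?_) _).symm
        obtain ⟨i, -, hi⟩ := Set.mem_iUnion₂.1 h'
        exact hx (Set.mem_iUnion.2 ⟨i, hi⟩)
  have hsimple : ∀ g : SimpleFunc α ℂ, P g := by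
    intro g
    induction g using SimpleFunc.induction with
    | const c hs =>
      rename_i s
      have hc : ⇑(SimpleFunc.piecewise s hs (SimpleFunc.const α c) (SimpleFunc.const α 0))
          = c • s.indicator (fun _ => (1 : ℂ)) := by
        ext x; simp [Set.indicator, Set.piecewise]
      rw [hc]
      exact smul _ _ (hmeas hs) (hbdd _) (hset s hs)
    | add _ hf hg =>
      exact add _ _ (SimpleFunc.measurable _) (SimpleFunc.exists_forall_norm_le _)
        (SimpleFunc.measurable _) (SimpleFunc.exists_forall_norm_le _) hf hg
  obtain ⟨D₀, hD₀⟩ := hfb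
  -- The bound is raised to be nonnegative, as `norm_approxBounded_le` requires; D₀ may be negative
  -- when α is empty.
  have hD : ∀ x, ‖f x‖ ≤ max D₀ 0 := fun x => (hD₀ x).trans (le_max_left _ _)
  have hsm : StronglyMeasurable f := hf.stronglyMeasurable
  exact lim (fun n => hsm.approxBounded (max D₀ 0) n) f (max D₀ 0)
    (fun n => SimpleFunc.measurable _)
    (fun n x => hsm.norm_approxBounded_le (le_max_right _ _) n x) hf hD
    (fun x => hsm.tendsto_approxBounded_of_norm_le (hD x)) fun n => hsimple _

/-- Induction over bounded measurable functions on a product, starting from measurable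
rectangles. -/
theorem bounded_measurable_prod_induction {Ξ S : Type*} [MeasurableSpace Ξ]
    [MeasurableSpace S] (P : (Ξ × S → ℂ) → Prop)
    (rect : ∀ (s : Set Ξ) (t : Set S), MeasurableSet s → MeasurableSet t →
      P ((s ×ˢ t).indicator fun _ => 1))
    (smul : ∀ (c : ℂ) f, Measurable f → (∃ D : ℝ, ∀ x, ‖f x‖ ≤ D) → P f → P (c • f))
    (add : ∀ f g, Measurable f → (∃ D : ℝ, ∀ x, ‖f x‖ ≤ D) → Measurable g →
      (∃ D : ℝ, ∀ x, ‖g x‖ ≤ D) → P f → P g → P (f + g))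
    (lim : ∀ (u : ℕ → Ξ × S → ℂ) f (D : ℝ), (∀ n, Measurable (u n)) → (∀ n x, ‖u n x‖ ≤ D) →
      Measurable f → (∀ x, ‖f x‖ ≤ D) →
      (∀ x, Tendsto (fun n => u n x) atTop (𝓝 (f x))) → (∀ n, P (u n)) → P f)
    {f : Ξ × S → ℂ} (hf : Measurable f) (hfb : ∃ D : ℝ, ∀ x, ‖f x‖ ≤ D) : P f := by
  refine bounded_measurable_induction generateFrom_prod.symm isPiSystem_prod P ?_ ?_ smul add lim
    hf hfb
  · rw [← Set.univ_prod_univ]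
    exact rect _ _ .univ .univ
  · rintro _ ⟨s, hs, t, ht, rfl⟩
    exact rect s t hs ht

/-! ### Linearity, continuity and boundedness of f ↦ Q(f). -/

namespace ProjectionValuedMeasure

variable {Ξ K : Type*} [MeasurableSpace Ξ] [NormedAddCommGroup K] [InnerProductSpace ℂ K]
  [CompleteSpace K] (Q : ProjectionValuedMeasure Ξ K)

theorem integrable_of_bounded (μ : ComplexMeasure Ξ) {f : Ξ → ℂ} (hf : Measurable f)
    (hb : ∃ C : ℝ, ∀ ξ, ‖f ξ‖ ≤ C) : μ.Integrable f := by
  have := isFiniteMeasure_variation μ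
  obtain ⟨C, hC⟩ := hb
  exact Integrable.of_bound hf.aestronglyMeasurable C (Eventually.of_forall hC)

/-- `cintegral` pairs through an ℝ-bilinear product; complex homogeneity holds because
multiplication by μ(s) commutes with complex scalars. -/
theorem cintegral_smul (μ : ComplexMeasure Ξ) (c : ℂ) (f : Ξ → ℂ) :
    cintegral μ (c • f) = c * cintegral μ f := by
  rw [cintegral, cintegral, VectorMeasure.integral_eq_setToFun, VectorMeasure.integral_eq_setToFun,
    ← smul_eq_mul, ← setToFun_smul]
  intro c s x
  simp [VectorMeasure.transpose, mul_left_comm]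

theorem integral_add {f g : Ξ → ℂ} (hf : Measurable f) (hfb : ∃ C : ℝ, ∀ ξ, ‖f ξ‖ ≤ C)
    (hg : Measurable g) (hgb : ∃ C : ℝ, ∀ ξ, ‖g ξ‖ ≤ C) :
    Q.integral (f + g) = Q.integral f + Q.integral g := by
  symm
  have hb : ∃ C : ℝ, ∀ ξ, ‖(f + g) ξ‖ ≤ C := by
    obtain ⟨C, hC⟩ := hfb
    obtain ⟨D, hD⟩ := hgb
    exact ⟨C + D, fun ξ => norm_add_le_of_le (hC ξ) (hD ξ)⟩
  refine Q.eq_integral (hf.add hg) hb fun h k => ?_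
  rw [add_apply, inner_add_right, Q.inner_integral hf hfb, Q.inner_integral hg hgb, cintegral,
    cintegral, cintegral,
    VectorMeasure.integral_add (integrable_of_bounded _ hf hfb) (integrable_of_bounded _ hg hgb)]

theorem integral_smul (c : ℂ) {f : Ξ → ℂ} (hf : Measurable f) (hfb : ∃ C : ℝ, ∀ ξ, ‖f ξ‖ ≤ C) :
    Q.integral (c • f) = c • Q.integral f := by
  symm
  have hb : ∃ C : ℝ, ∀ ξ, ‖(c • f) ξ‖ ≤ C := by
    obtain ⟨C, hC⟩ := hfb
    refine ⟨‖c‖ * C, fun ξ => ?_⟩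
    rw [Pi.smul_apply, norm_smul]
    gcongr
    exact hC ξ
  refine Q.eq_integral (hf.const_smul c) hb fun h k => ?_
  rw [smul_apply, inner_smul_right, Q.inner_integral hf hfb, cintegral_smul]

theorem tendsto_inner_integral {u : ℕ → Ξ → ℂ} {f : Ξ → ℂ} {D : ℝ} (hu : ∀ n, Measurable (u n))
    (huD : ∀ n ξ, ‖u n ξ‖ ≤ D) (hf : Measurable f) (hfD : ∀ ξ, ‖f ξ‖ ≤ D)
    (hlim : ∀ ξ, Tendsto (fun n => u n ξ) atTop (𝓝 (f ξ))) (h k : K) :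
    Tendsto (fun n => ⟪k, Q.integral (u n) h⟫_ℂ) atTop (𝓝 ⟪k, Q.integral f h⟫_ℂ) := by
  have := isFiniteMeasure_variation (Q.coord h k)
  simp only [fun n => Q.inner_integral (hu n) ⟨D, huD n⟩, Q.inner_integral hf ⟨D, hfD⟩]
  exact VectorMeasure.tendsto_integral_of_dominated_convergence (fun _ => D)
    (fun n => (hu n).aestronglyMeasurable) (integrable_const _)
    (fun n => Eventually.of_forall fun x => huD n x) (Eventually.of_forall fun x => hlim x)

/-- Uniform boundedness, applied twice over all admissible f at once: for fixed h and k the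
coefficient is at most a constant times the total variation of Q_{h,k}. -/
theorem exists_norm_integral_le (D : ℝ) :
    ∃ E : ℝ, ∀ f : Ξ → ℂ, Measurable f → (∀ ξ, ‖f ξ‖ ≤ D) → ‖Q.integral f‖ ≤ E := by
  let I := {f : Ξ → ℂ // Measurable f ∧ ∀ ξ, ‖f ξ‖ ≤ D}
  obtain ⟨E, hE⟩ : ∃ E, ∀ f : I, ‖Q.integral f.1‖ ≤ E := by
    refine banach_steinhaus fun h => ?_
    obtain ⟨E, hE⟩ := banach_steinhaus (g := fun f : I => innerSL ℂ (Q.integral f.1 h)) (by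
      intro k
      have := isFiniteMeasure_variation (Q.coord h k)
      refine ⟨D * ‖ContinuousLinearMap.mul ℝ ℂ‖ * (Q.coord h k).variation.real Set.univ,
        fun f => ?_⟩
      rw [innerSL_apply_apply, norm_inner_symm, Q.inner_integral f.2.1 ⟨D, f.2.2⟩]
      exact VectorMeasure.norm_integral_le_of_norm_le_const (Eventually.of_forall f.2.2))
    exact ⟨E, fun f => by simpa using hE f⟩
  exact ⟨E, fun f hf hD => hE ⟨f, hf, hD⟩⟩

end ProjectionValuedMeasure

/-! ### Products with the operators Q(φ(·, σ)), and the theorem. -/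

section TraceOfProduct

open ContinuousLinearMap

variable {Ξ S K : Type*} [NormedAddCommGroup K] [InnerProductSpace ℂ K]

theorem PointwiseWeaklyMeasurable.pettisIntegrable_of_bound [MeasurableSpace S]
    {ρ : Measure S} [IsFiniteMeasure ρ] {F : S → K →L[ℂ] K} (hF : PointwiseWeaklyMeasurable F)
    {D : ℝ} (hD : ∀ σ, ‖F σ‖ ≤ D) :
    PointwisePettisIntegrable F ρ := by
  refine ⟨hF, fun h k => Integrable.of_bound (hF h k).aestronglyMeasurable (‖k‖ * (D * ‖h‖))
    (Eventually.of_forall fun σ => ?_)⟩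
  refine (norm_inner_le_norm _ _).trans ?_
  gcongr
  exact (le_opNorm _ _).trans (by gcongr; exact hD σ)

variable [CompleteSpace K]

theorem opTrace_add {T T' : K →L[ℂ] K} (hT : IsTraceClass T) (hT' : IsTraceClass T') :
    opTrace (T + T') = opTrace T + opTrace T' := by
  simp only [opTrace, add_apply, inner_add_right]
  exact hT.summable.tsum_add hT'.summable

theorem opTrace_smul (c : ℂ) (T : K →L[ℂ] K) : opTrace (c • T) = c * opTrace T := by
  simp only [opTrace, smul_apply, inner_smul_right, tsum_mul_left]

/-- U moves across the inner product as U* on the left of A(σ), contributing at most 1; X(σ)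
contributes E². -/
theorem traceBoundedBy_comp_right {A X : S → K →L[ℂ] K} {M : ℝ≥0∞} (hA : ∀ σ, traceNorm (A σ) ≤ M)
    {E : ℝ} (hX : ∀ σ, ‖X σ‖ ≤ E) :
    TraceBoundedBy (fun σ => A σ ∘L X σ) ((1 + ENNReal.ofReal E ^ 2) * M) := by
  intro σ U hU
  have h := tsum_enorm_inner_le_traceNorm (A σ) (adjoint U) (X σ)
  simp only [adjoint_inner_right] at h
  refine h.trans ?_
  rw [enorm_adjoint, ← ofReal_norm U, ← ofReal_norm (X σ)]
  have h1 : ENNReal.ofReal ‖U‖ ^ 2 ≤ 1 := pow_le_one' (ENNReal.ofReal_le_one.2 hU) 2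
  gcongr
  · exact hX σ
  · exact hA σ

theorem traceBoundedBy_comp_left {A X : S → K →L[ℂ] K} {M : ℝ≥0∞} (hA : ∀ σ, traceNorm (A σ) ≤ M)
    {E : ℝ} (hX : ∀ σ, ‖X σ‖ ≤ E) :
    TraceBoundedBy (fun σ => X σ ∘L A σ) ((1 + ENNReal.ofReal E ^ 2) * M) := by
  intro σ U hU
  have h := tsum_enorm_inner_le_traceNorm (A σ) (adjoint U ∘L X σ) (.id ℂ K)
  simp only [comp_apply, adjoint_inner_right, id_apply] at h
  refine h.trans ?_
  have h1 : ‖adjoint U ∘L X σ‖ ≤ E := by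
    refine (opNorm_comp_le _ _).trans ?_
    rw [LinearIsometryEquiv.norm_map]
    exact (mul_le_of_le_one_left (norm_nonneg _) hU).trans (hX σ)
  rw [← ofReal_norm, ← ofReal_norm (ContinuousLinearMap.id ℂ K), add_comm (1 : ℝ≥0∞)]
  have h2 : ENNReal.ofReal ‖(.id ℂ K : K →L[ℂ] K)‖ ^ 2 ≤ 1 :=
    pow_le_one' (ENNReal.ofReal_le_one.2 norm_id_le) 2
  gcongr
  exact hA σ

theorem norm_le_traceNorm_toReal {A : K →L[ℂ] K} {M : ℝ≥0∞} (hA : traceNorm A ≤ M) (hM : M ≠ ⊤) :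
    ‖A‖ ≤ M.toReal := by
  refine opNorm_le_bound _ ENNReal.toReal_nonneg fun x => ?_
  rw [← toReal_enorm, ← toReal_enorm x, ← ENNReal.toReal_mul]
  refine ENNReal.toReal_mono (ENNReal.mul_ne_top hM (by simp)) ?_
  exact (enorm_apply_le_traceNorm A x).trans (by gcongr)

section PettisIntegral

variable [MeasurableSpace S] {ρ : Measure S}

theorem pettisIntegral_add {F G : S → K →L[ℂ] K} (hF : PointwisePettisIntegrable F ρ)
    (hG : PointwisePettisIntegrable G ρ) :
    pettisIntegral (fun σ => F σ + G σ) ρ = pettisIntegral F ρ + pettisIntegral G ρ := by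
  have h : PointwisePettisIntegrable (fun σ => F σ + G σ) ρ := by
    refine ⟨fun h k => ?_, fun h k => ?_⟩
    · simpa only [add_apply, inner_add_right] using! (hF.1 h k).add (hG.1 h k)
    · simpa only [add_apply, inner_add_right] using! (hF.2 h k).add (hG.2 h k)
  refine (h.eq_pettisIntegral fun x k => ?_).symm
  simp only [add_apply, inner_add_right, hF.inner_pettisIntegral, hG.inner_pettisIntegral]
  exact (integral_add (hF.2 x k) (hG.2 x k)).symm

theorem pettisIntegral_smul {F : S → K →L[ℂ] K} (hF : PointwisePettisIntegrable F ρ) (c : ℂ) :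
    pettisIntegral (fun σ => c • F σ) ρ = c • pettisIntegral F ρ := by
  have h : PointwisePettisIntegrable (fun σ => c • F σ) ρ := by
    refine ⟨fun h k => ?_, fun h k => ?_⟩
    · simpa only [smul_apply, inner_smul_right] using (hF.1 h k).const_mul c
    · simpa only [smul_apply, inner_smul_right] using (hF.2 h k).const_mul c
  refine (h.eq_pettisIntegral fun x k => ?_).symm
  simp only [smul_apply, inner_smul_right, hF.inner_pettisIntegral]
  exact (integral_const_mul _ _).symm

end PettisIntegral

namespace ProjectionValuedMeasure

variable [MeasurableSpace Ξ] (Q : ProjectionValuedMeasure Ξ K)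

/-- The operators `Q(φ(·, σ))`. -/
noncomputable def slice (φ : Ξ × S → ℂ) (σ : S) : K →L[ℂ] K := Q.integral fun ξ => φ (ξ, σ)

theorem slice_prod {s : Set Ξ} (hs : MeasurableSet s) (t : Set S) (σ : S) :
    Q.slice ((s ×ˢ t).indicator fun _ => 1) σ =
      t.indicator (fun _ => (1 : ℂ)) σ • Q.integral (s.indicator fun _ => 1) := by
  classical
  rw [slice, ← Q.integral_smul _ (measurable_const.indicator hs)
    ⟨1, fun ξ => (norm_indicator_le_norm_self _ _).trans (by simp)⟩]
  congr 1
  ext ξ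
  by_cases h1 : ξ ∈ s <;> by_cases h2 : σ ∈ t <;> simp [h1, h2]

variable [MeasurableSpace S] {ρ : Measure S}

theorem slice_add {f g : Ξ × S → ℂ} (hf : Measurable f) (hfb : ∃ C : ℝ, ∀ x, ‖f x‖ ≤ C)
    (hg : Measurable g) (hgb : ∃ C : ℝ, ∀ x, ‖g x‖ ≤ C) (σ : S) :
    Q.slice (f + g) σ = Q.slice f σ + Q.slice g σ :=
  Q.integral_add (hf.comp measurable_prodMk_right) (hfb.imp fun _ h _ => h _)
    (hg.comp measurable_prodMk_right) (hgb.imp fun _ h _ => h _)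

theorem slice_smul (c : ℂ) {f : Ξ × S → ℂ} (hf : Measurable f) (hfb : ∃ C : ℝ, ∀ x, ‖f x‖ ≤ C)
    (σ : S) : Q.slice (c • f) σ = c • Q.slice f σ :=
  Q.integral_smul c (hf.comp measurable_prodMk_right) (hfb.imp fun _ h _ => h _)

theorem tendsto_inner_slice {u : ℕ → Ξ × S → ℂ} {f : Ξ × S → ℂ} {D : ℝ}
    (hu : ∀ n, Measurable (u n)) (huD : ∀ n x, ‖u n x‖ ≤ D) (hf : Measurable f)
    (hfD : ∀ x, ‖f x‖ ≤ D) (hlim : ∀ x, Tendsto (fun n => u n x) atTop (𝓝 (f x))) (σ : S)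
    (h k : K) : Tendsto (fun n => ⟪k, Q.slice (u n) σ h⟫_ℂ) atTop (𝓝 ⟪k, Q.slice f σ h⟫_ℂ) :=
  Q.tendsto_inner_integral (fun n => (hu n).comp measurable_prodMk_right) (fun n _ => huD n _)
    (hf.comp measurable_prodMk_right) (fun _ => hfD _) (fun _ => hlim _) h k

theorem exists_norm_slice_le (D : ℝ) :
    ∃ E : ℝ, ∀ f : Ξ × S → ℂ, Measurable f → (∀ x, ‖f x‖ ≤ D) → ∀ σ, ‖Q.slice f σ‖ ≤ E := by
  obtain ⟨E, hE⟩ := Q.exists_norm_integral_le D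
  exact ⟨E, fun f hf hD σ => hE _ (hf.comp measurable_prodMk_right) fun _ => hD _⟩

variable {A : S → K →L[ℂ] K} {φ : Ξ × S → ℂ}

/-- Induction on φ. For a rectangle the coefficient is an indicator in σ times a coefficient of A,
with Q(s) absorbed into h or, through its adjoint, into k. -/
theorem pointwiseWeaklyMeasurable_slice (hA : PointwiseWeaklyMeasurable A) (hφ : Measurable φ)
    (hφb : ∃ C : ℝ, ∀ x, ‖φ x‖ ≤ C) :
    PointwiseWeaklyMeasurable (fun σ => A σ ∘L Q.slice φ σ) ∧
      PointwiseWeaklyMeasurable (fun σ => Q.slice φ σ ∘L A σ) := by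
  refine bounded_measurable_prod_induction (fun φ : Ξ × S → ℂ =>
    PointwiseWeaklyMeasurable (fun σ => A σ ∘L Q.slice φ σ) ∧
      PointwiseWeaklyMeasurable (fun σ => Q.slice φ σ ∘L A σ))
    ?_ ?_ ?_ ?_ hφ hφb
  · intro s t hs ht
    have hc : Measurable (t.indicator fun _ => (1 : ℂ)) := measurable_const.indicator ht
    refine ⟨fun h k => ?_, fun h k => ?_⟩
    · simpa [slice_prod Q hs, inner_smul_right] using!
        hc.mul (hA (Q.integral (s.indicator fun _ => 1) h) k)
    · simpa [slice_prod Q hs, inner_smul_right, adjoint_inner_left] using!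
        hc.mul (hA h (adjoint (Q.integral (s.indicator fun _ => 1)) k))
  · intro c f hf hfb ih
    refine ⟨fun h k => ?_, fun h k => ?_⟩
    · simpa [slice_smul Q c hf hfb, inner_smul_right] using (ih.1 h k).const_mul c
    · simpa [slice_smul Q c hf hfb, inner_smul_right] using (ih.2 h k).const_mul c
  · intro f g hf hfb hg hgb ihf ihg
    refine ⟨fun h k => ?_, fun h k => ?_⟩
    · simpa [slice_add Q hf hfb hg hgb, inner_add_right] using! (ihf.1 h k).add (ihg.1 h k)
    · simpa [slice_add Q hf hfb hg hgb, inner_add_right] using! (ihf.2 h k).add (ihg.2 h k)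
  · intro u f D hu huD hf hfD hlim ih
    refine ⟨fun h k => ?_, fun h k => ?_⟩
    · refine measurable_of_tendsto_metrizable (fun n => (ih n).1 h k)
        (tendsto_pi_nhds.2 fun σ => ?_)
      simpa [adjoint_inner_left] using
        Q.tendsto_inner_slice hu huD hf hfD hlim σ h (adjoint (A σ) k)
    · exact measurable_of_tendsto_metrizable (fun n => (ih n).2 h k)
        (tendsto_pi_nhds.2 fun σ => Q.tendsto_inner_slice hu huD hf hfD hlim σ (A σ h) k)

variable [IsFiniteMeasure ρ] {M : ℝ≥0∞}

theorem pointwisePettisIntegrable_slice (hA : PointwiseWeaklyMeasurable A)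
    (hAM : ∀ σ, traceNorm (A σ) ≤ M) (hM : M ≠ ⊤) (hφ : Measurable φ)
    (hφb : ∃ C : ℝ, ∀ x, ‖φ x‖ ≤ C) :
    PointwisePettisIntegrable (fun σ => A σ ∘L Q.slice φ σ) ρ ∧
      PointwisePettisIntegrable (fun σ => Q.slice φ σ ∘L A σ) ρ := by
  have hmeas := Q.pointwiseWeaklyMeasurable_slice hA hφ hφb
  obtain ⟨C, hC⟩ := hφb
  obtain ⟨E, hE⟩ := Q.exists_norm_slice_le (S := S) C
  have hX := hE φ hφ hC
  have hA' := fun σ => norm_le_traceNorm_toReal (hAM σ) hM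
  exact ⟨hmeas.1.pettisIntegrable_of_bound (D := M.toReal * E) fun σ =>
      (opNorm_comp_le _ _).trans
        (mul_le_mul (hA' σ) (hX σ) (norm_nonneg _) ENNReal.toReal_nonneg),
    hmeas.2.pettisIntegrable_of_bound (D := E * M.toReal) fun σ =>
      (opNorm_comp_le _ _).trans
        (mul_le_mul (hX σ) (hA' σ) (norm_nonneg _) ((norm_nonneg _).trans (hX σ)))⟩

theorem isTraceClass_pettisIntegral_slice (hA : PointwiseWeaklyMeasurable A)
    (hAM : ∀ σ, traceNorm (A σ) ≤ M) (hM : M ≠ ⊤) (hφ : Measurable φ)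
    (hφb : ∃ C : ℝ, ∀ x, ‖φ x‖ ≤ C) :
    IsTraceClass (pettisIntegral (fun σ => A σ ∘L Q.slice φ σ) ρ) ∧
      IsTraceClass (pettisIntegral (fun σ => Q.slice φ σ ∘L A σ) ρ) := by
  have hint := Q.pointwisePettisIntegrable_slice (ρ := ρ) hA hAM hM hφ hφb
  obtain ⟨C, hC⟩ := hφb
  obtain ⟨E, hE⟩ := Q.exists_norm_slice_le (S := S) C
  have hX := hE φ hφ hC
  have htop : (1 + ENNReal.ofReal E ^ 2) * M ≠ ⊤ := ENNReal.mul_ne_top (by simp) hM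
  exact ⟨hint.1.isTraceClass_pettisIntegral (traceBoundedBy_comp_right hAM hX) htop,
    hint.2.isTraceClass_pettisIntegral (traceBoundedBy_comp_left hAM hX) htop⟩

/-- Put T = ∫ 1_t A dρ. The fixed operator X = Q(s) leaves both integrals, giving TX and XT. -/
theorem opTrace_pettisIntegral_slice_prod (hA : PointwiseWeaklyMeasurable A)
    (hAM : ∀ σ, traceNorm (A σ) ≤ M) (hM : M ≠ ⊤) {s : Set Ξ} {t : Set S} (hs : MeasurableSet s)
    (ht : MeasurableSet t) :
    opTrace (pettisIntegral (fun σ => A σ ∘L Q.slice ((s ×ˢ t).indicator fun _ => 1) σ) ρ) =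
      opTrace (pettisIntegral (fun σ => Q.slice ((s ×ˢ t).indicator fun _ => 1) σ ∘L A σ) ρ) := by
  have hbd : ∃ C : ℝ, ∀ x, ‖(s ×ˢ t).indicator (fun _ => (1 : ℂ)) x‖ ≤ C :=
    ⟨1, fun ξ => (norm_indicator_le_norm_self _ _).trans (by simp)⟩
  have hint := Q.pointwisePettisIntegrable_slice (ρ := ρ) hA hAM hM
    (measurable_const.indicator (hs.prod ht)) hbd
  set X := Q.integral (s.indicator fun _ => 1)
  let c : S → ℂ := t.indicator fun _ => 1
  have hc : ∀ σ, ‖c σ • ContinuousLinearMap.id ℂ K‖ ≤ 1 := fun σ => by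
    rw [norm_smul]
    refine mul_le_one₀ ((norm_indicator_le_norm_self _ _).trans (by simp)) (norm_nonneg _)
      norm_id_le
  -- The scalar is written as an operator factor so that `traceBoundedBy_comp_right` applies with E
  -- = 1.
  let F : S → K →L[ℂ] K := fun σ => A σ ∘L (c σ • .id ℂ K)
  have hFm : PointwiseWeaklyMeasurable F := fun h k => by
    simpa [F, inner_smul_right] using! (measurable_const.indicator ht).mul (hA h k)
  have hF : PointwisePettisIntegrable F ρ :=
    hFm.pettisIntegrable_of_bound (D := M.toReal * 1) fun σ => (opNorm_comp_le _ _).trans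
      (mul_le_mul (norm_le_traceNorm_toReal (hAM σ) hM) (hc σ) (norm_nonneg _)
        ENNReal.toReal_nonneg)
  have hT : IsTraceClass (pettisIntegral F ρ) :=
    hF.isTraceClass_pettisIntegral (traceBoundedBy_comp_right hAM hc)
      (ENNReal.mul_ne_top (by simp) hM)
  have h1 := hint.1.eq_pettisIntegral (T := pettisIntegral F ρ ∘L X) fun h k => by
    rw [comp_apply, hF.inner_pettisIntegral]
    simp [F, slice_prod Q hs, X, c]
  have h2 := hint.2.eq_pettisIntegral (T := X ∘L pettisIntegral F ρ) fun h k => by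
    rw [comp_apply, ← adjoint_inner_left, hF.inner_pettisIntegral]
    simp [F, slice_prod Q hs, X, c, adjoint_inner_left]
  rw [← h1, ← h2]
  exact hT.opTrace_comp_comm X

theorem opTrace_pettisIntegral_slice (hA : PointwiseWeaklyMeasurable A)
    (hAM : ∀ σ, traceNorm (A σ) ≤ M) (hM : M ≠ ⊤) (hφ : Measurable φ)
    (hφb : ∃ C : ℝ, ∀ x, ‖φ x‖ ≤ C) :
    opTrace (pettisIntegral (fun σ => A σ ∘L Q.slice φ σ) ρ) =
      opTrace (pettisIntegral (fun σ => Q.slice φ σ ∘L A σ) ρ) := by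
  have hint := fun {φ : Ξ × S → ℂ} (hφ : Measurable φ) hφb =>
    Q.pointwisePettisIntegrable_slice (ρ := ρ) hA hAM hM hφ hφb
  have htr := fun {φ : Ξ × S → ℂ} (hφ : Measurable φ) hφb =>
    Q.isTraceClass_pettisIntegral_slice (ρ := ρ) hA hAM hM hφ hφb
  refine bounded_measurable_prod_induction (fun φ : Ξ × S → ℂ =>
    opTrace (pettisIntegral (fun σ => A σ ∘L Q.slice φ σ) ρ) =
      opTrace (pettisIntegral (fun σ => Q.slice φ σ ∘L A σ) ρ))
    ?_ ?_ ?_ ?_ hφ hφb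
  · intro s t hs ht
    exact Q.opTrace_pettisIntegral_slice_prod hA hAM hM hs ht
  · intro c f hf hfb ih
    simp only [slice_smul Q c hf hfb, comp_smul, smul_comp, pettisIntegral_smul (hint hf hfb).1,
      pettisIntegral_smul (hint hf hfb).2, opTrace_smul, ih]
  · intro f g hf hfb hg hgb ihf ihg
    simp only [slice_add Q hf hfb hg hgb, comp_add, add_comp,
      pettisIntegral_add (hint hf hfb).1 (hint hg hgb).1,
      pettisIntegral_add (hint hf hfb).2 (hint hg hgb).2,
      opTrace_add (htr hf hfb).1 (htr hg hgb).1, opTrace_add (htr hf hfb).2 (htr hg hgb).2,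
      ihf, ihg]
  · intro u f D hu huD hf hfD hlim ih
    obtain ⟨E, hE⟩ := Q.exists_norm_slice_le (S := S) D
    have htop : (1 + ENNReal.ofReal E ^ 2) * M ≠ ⊤ := ENNReal.mul_ne_top (by simp) hM
    have hAtr : ∀ σ, IsTraceClass (A σ) := fun σ => (hAM σ).trans_lt hM.lt_top
    have hbound : ∀ (P : K →L[ℂ] K) n σ, ‖Q.slice (u n) σ‖ * ‖P‖ ≤ E * ‖P‖ := fun P n σ => by
      gcongr
      exact hE _ (hu n) (huD n) σ
    have hw := Q.tendsto_inner_slice hu huD hf hfD hlim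
    have h1 := tendsto_opTrace_pettisIntegral (fun n => (hint (hu n) ⟨D, huD n⟩).1)
      (hint hf ⟨D, hfD⟩).1
      (fun n => traceBoundedBy_comp_right hAM (hE _ (hu n) (huD n)))
      (traceBoundedBy_comp_right hAM (hE _ hf hfD)) htop fun σ P => by
        -- P* stands to the left of A(σ) and the convergent factor to its right; below, both stand
        -- to its left, as P*Q(uₙ(·,σ)).
        have h := tendsto_tsum_inner_comp (hAtr σ) (X := fun _ => adjoint P)
          (Y := fun n => Q.slice (u n) σ) (X' := adjoint P) (Y' := Q.slice f σ)
          (D := E * ‖adjoint P‖)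
          (fun n => (opNorm_comp_le _ _).trans (hbound _ n σ)) fun h k => hw σ _ k
        simpa only [adjoint_inner_right] using! h
    have h2 := tendsto_opTrace_pettisIntegral (fun n => (hint (hu n) ⟨D, huD n⟩).2)
      (hint hf ⟨D, hfD⟩).2
      (fun n => traceBoundedBy_comp_left hAM (hE _ (hu n) (huD n)))
      (traceBoundedBy_comp_left hAM (hE _ hf hfD)) htop fun σ P => by
        have h := tendsto_tsum_inner_comp (hAtr σ) (X := fun n => adjoint P ∘L Q.slice (u n) σ)
          (Y := fun _ => .id ℂ K) (X' := adjoint P ∘L Q.slice f σ) (Y' := .id ℂ K)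
          (D := E * ‖adjoint P‖)
          (fun n => by
            rw [id_comp]
            exact (opNorm_comp_le _ _).trans ((mul_comm _ _).le.trans (hbound _ n σ)))
          fun h k => by
            simpa only [id_apply, comp_apply, adjoint_inner_right] using hw σ h (P k)
        simpa only [adjoint_inner_right, comp_apply, id_apply] using h
    simp only [ih] at h1
    exact tendsto_nhds_unique h1 h2

end ProjectionValuedMeasure

end TraceOfProduct

theorem theorem1p7 {Ξ S K : Type*} [MeasurableSpace Ξ] [MeasurableSpace S]
    [NormedAddCommGroup K] [InnerProductSpace ℂ K] [CompleteSpace K]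
    (Q : ProjectionValuedMeasure Ξ K) (ρ : Measure S) [IsFiniteMeasure ρ]
    (φ : Ξ × S → ℂ) (hφ : Measurable φ) (hφb : ∃ C : ℝ, ∀ x, ‖φ x‖ ≤ C)
    (A : S → K →L[ℂ] K) (hA : PointwiseWeaklyMeasurable A)
    (hA1 : (⨆ σ, traceNorm (A σ)) < ⊤) :
    PointwisePettisIntegrable (fun σ => A σ ∘L Q.integral (fun ξ => φ (ξ, σ))) ρ ∧
    PointwisePettisIntegrable (fun σ => Q.integral (fun ξ => φ (ξ, σ)) ∘L A σ) ρ ∧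
    IsTraceClass (pettisIntegral (fun σ => A σ ∘L Q.integral (fun ξ => φ (ξ, σ))) ρ) ∧
    IsTraceClass (pettisIntegral (fun σ => Q.integral (fun ξ => φ (ξ, σ)) ∘L A σ) ρ) ∧
    opTrace (pettisIntegral (fun σ => A σ ∘L Q.integral (fun ξ => φ (ξ, σ))) ρ) =
      opTrace (pettisIntegral (fun σ => Q.integral (fun ξ => φ (ξ, σ)) ∘L A σ) ρ) := by
  have hAM : ∀ σ, traceNorm (A σ) ≤ ⨆ σ, traceNorm (A σ) := le_iSup fun σ => traceNorm (A σ)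
  have h1 := Q.pointwisePettisIntegrable_slice (ρ := ρ) hA hAM hA1.ne hφ hφb
  have h2 := Q.isTraceClass_pettisIntegral_slice (ρ := ρ) hA hAM hA1.ne hφ hφb
  exact ⟨h1.1, h1.2, h2.1, h2.2, Q.opTrace_pettisIntegral_slice hA hAM hA1.ne hφ hφb⟩
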